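/- Let $\mathcal X,\mathcal Y$ be finite alphabets, $P_X,P_Y$ probability distributions on $\mathcal X,\mathcal Y$, $d(\cdot,\cdot):\mathcal X\times\mathcal Y\to\mathbb R$ an arbitrary function, and $d\in\mathbb R$ a threshold. For $n\ge 1$ put $d(x^n,y^n):=\frac1n\sum_{i=1}^n d(x_i,y_i)$, and let $P_X^n,P_Y^n$ be the $n$-fold product distributions. Let $C(P,Q)$ denote the set of couplings of $P$ and $Q$ (joint distributions with marginals $P$ and $Q$), and define $$\mathcal D(P_X,P_Y):=\min_{P_{XY}\in C(P_X,P_Y)}\mathbb E\,d(X,Y),\qquad \widetilde{\mathcal D}_d(P_X^n,P_Y^n):=\min_{P_{X^nY^n}\in C(P_X^n,P_Y^n)}\mathbb P\{d(X^n,Y^n)>d\}.$$ Define, with values in $[0,\infty]$ and $-\log 0=\infty$, $$\overline{\mathsf E}(d):=\liminf_{n\to\infty}-\tfrac1n\log\bigl(1-\widetilde{\mathcal D}_d(P_X^n,P_Y^n)\bigr),\qquad \mathsf E(d):=\liminf_{n\to\infty}-\tfrac1n\log\widetilde{\mathcal D}_d(P_X^n,P_Y^n).$$ Then: 1. If $\mathcal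 D(P_X,P_Y)>d$, then $\widetilde{\mathcal D}_d(P_X^n,P_Y^n)\to1$ exponentially fast, i.e. there are constants $C$ and $\kappa>0$ with $1-\widetilde{\mathcal D}_d(P_X^n,P_Y^n)\le Ce^{-\kappa n}$ for all $n$. Moreover $$\overline{\mathsf E}(d)=\min_{Q_{XY}\in\mathcal P(\mathcal X\times\mathcal Y):\ \mathbb E_Q d(X,Y)\le d}\max\{D(Q_X\|P_X),D(Q_Y\|P_Y)\},$$ where $D(\cdot\|\cdot)\in[0,\infty]$ is the relative entropy, the minimum is attained whenever the constraint set is non-empty, and it is $+\infty$ if the constraint set is empty. 2. If $\mathcal D(P_X,P_Y)<d$, then $\widetilde{\mathcal D}_d(P_X^n,P_Y^n)\to0$ at least exponentially fast, i.e. there are constants $C$ and $\kappa>0$ with $\widetilde{\mathcal D}_d(P_X^n,P_Y^n)\le Ce^{-\kappa n}$ for all $n$. Moreover, for every coupling $P_{XY}\in C(P_X,P_Y)$ (in particular for every one that attains $\mathcal D(P_X,P_Y)$), $$\mathsf E(d)\ \ge\ \sup_{t\ge0}\bigl(td-\log\mathbb E_{P_{XY}}e^{t\,d(X,Y)}\bigr),$$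 the supremum being taken in $[0,\infty]$. 3. If $\mathcal D(P_X,P_Y)=d$, then $$\tfrac12+O\bigl(\tfrac1{\sqrt n}\bigr)\ \le\ 1-\widetilde{\mathcal D}_d(P_X^n,P_Y^n)=\max_{P_{X^nY^n}\in C(P_X^n,P_Y^n)}\mathbb P\{d(X^n,Y^n)\le d\}\ \le\ 1 .$$ -/

import Mathlib

open MeasureTheory Filter Topology Asymptotics InformationTheory
open scoped ENNReal

/-- The set `C(μ, ν)` of couplings: joint probability measures with marginals `μ` and `ν`. -/
def couplings {α β : Type*} [MeasurableSpace α] [MeasurableSpace β]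
    (μ : Measure α) (ν : Measure β) : Set (Measure (α × β)) :=
  {π | IsProbabilityMeasure π ∧ π.fst = μ ∧ π.snd = ν}

/-- The minimum expected distance over couplings of `μ` and `ν`, for the distance `δ`.
(On finite alphabets, the set is nonempty and compact, so the infimum is a minimum.) -/
noncomputable def minDist {α β : Type*} [MeasurableSpace α] [MeasurableSpace β]
    (δ : α → β → ℝ) (μ : Measure α) (ν : Measure β) : ℝ :=
  sInf ((fun π : Measure (α × β) => ∫ z, δ z.1 z.2 ∂π) '' couplings μ ν)

/-- The minimum of the excess-distance probability `ℙ(δ(X, Y) > d)` over couplings of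
`μ` and `ν`. -/
noncomputable def minExcessProb {α β : Type*} [MeasurableSpace α] [MeasurableSpace β]
    (δ : α → β → ℝ) (d : ℝ) (μ : Measure α) (ν : Measure β) : ℝ :=
  sInf ((fun π : Measure (α × β) => π.real {z | d < δ z.1 z.2}) '' couplings μ ν)

/-- The additive distance `(1/n) ∑ i, δ(x i, y i)` on sequences of length `n`. -/
noncomputable def avgDist {X Y : Type*} (δ : X → Y → ℝ) (n : ℕ)
    (x : Fin n → X) (y : Fin n → Y) : ℝ :=
  (1 / (n : ℝ)) * ∑ i, δ (x i) (y i)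

/-- The `n`-fold product distribution `P^n`. -/
noncomputable def iidLaw {X : Type*} [MeasurableSpace X] (P : Measure X) (n : ℕ) :
    Measure (Fin n → X) :=
  Measure.pi fun _ : Fin n => P

/-- The minimum excess-distance probability of the product distributions `PX^n`, `PY^n`, for
the additive distance. -/
noncomputable def minExcessProbIID {X Y : Type*} [MeasurableSpace X] [MeasurableSpace Y]
    (δ : X → Y → ℝ) (d : ℝ) (PX : Measure X) (PY : Measure Y) (n : ℕ) : ℝ :=
  minExcessProb (avgDist δ n) d (iidLaw PX n) (iidLaw PY n)

/-- The exponent `liminf (-(1/n) log (a n))` of a nonnegative sequence, with values in the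
extended reals and `-log 0 = +∞`. -/
noncomputable def decayExponent (a : ℕ → ℝ) : EReal :=
  liminf (fun n : ℕ => (-ENNReal.log (ENNReal.ofReal (a n))) / (n : EReal)) atTop

/-- Joint distributions under which the expected distance is at most `d`. -/
def distFeasible {X Y : Type*} [MeasurableSpace X] [MeasurableSpace Y]
    (δ : X → Y → ℝ) (d : ℝ) : Set (Measure (X × Y)) :=
  {Q | IsProbabilityMeasure Q ∧ ∫ z, δ z.1 z.2 ∂Q ≤ d}

/-- `max {D(Q_X ‖ PX), D(Q_Y ‖ PY)}`, for the marginals `Q_X`, `Q_Y` of `Q`. -/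
noncomputable def maxMarginalDiv {X Y : Type*} [MeasurableSpace X] [MeasurableSpace Y]
    (PX : Measure X) (PY : Measure Y) (Q : Measure (X × Y)) : EReal :=
  ((max (klDiv Q.fst PX) (klDiv Q.snd PY) : ℝ≥0∞) : EReal)

/-! The upper bounds on the probability of small distance use that both marginals of every coupling
are fixed product laws; all other bounds exhibit a coupling.

Parts 2 and 3 use the `n`-fold power of a single-letter coupling. Chernoff's bound for it
(`minExcessProbIID_le_exp`) gives the exponent, which is positive for some small `t > 0` as soon as
the mean distance is below `d`. If the mean equals `d`, the law of large numbers is silent and a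
Gaussian estimate at the median is needed: a normalised sum is at most its mean with probability at
least `1 / 2 - O(1 / √n)`. This is `exists_half_sub_le_iidLaw`, proved by Stein's method for the
indicator of `(-∞, 0]`, whose Stein solution is half the Mills ratio of `|w|`.

In part 1 the converse is the method of types (`one_sub_minExcessProbIID_le`). The event of small
distance is a union of polynomially many joint type classes. The type of each is a feasible `Q`, and
the class projects into a type class in each marginal, so its probability is at most about `exp (-n
* max {D(Q_X‖P_X), D(Q_Y‖P_Y)})` under every coupling. For achievability
(`eventually_le_one_sub_minExcessProbIID`), take a feasible `Q`, restrict `Q^n` to pairs with small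
distance and typical likelihood ratios, and scale by `exp (-(e * n))`. The marginals are then
dominated by the product laws, and `exists_coupling_ge` completes this sub-coupling. The half bound
keeps the restricted mass away from zero even when the `Q`-mean is exactly `d`.

Compactness of the simplex gives attainment. When the transport cost exceeds `d` the minimum is
positive, since a minimiser of zero divergence would be a coupling of cost at most `d`. -/

set_option linter.unusedSectionVars false

/-! ### The Mills ratio and a Stein solution at the origin -/

/-- The unnormalised Gaussian tail `∫ u in (x, ∞), exp (-u² / 2)`. -/
noncomputable def gaussTail (x : ℝ) : ℝ :=
  √(Real.pi / (1 / 2)) / 2 - ∫ u in (0 : ℝ)..x, Real.exp (-(1 / 2) * u ^ 2)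

lemma hasDerivAt_gaussTail (x : ℝ) :
    HasDerivAt gaussTail (-Real.exp (-(1 / 2) * x ^ 2)) x := by
  have hc : Continuous fun u : ℝ => Real.exp (-(1 / 2) * u ^ 2) := by fun_prop
  exact (hc.integral_hasStrictDerivAt 0 x).hasDerivAt.const_sub _

lemma tendsto_gaussTail : Tendsto gaussTail atTop (𝓝 0) := by
  have h := intervalIntegral_tendsto_integral_Ioi (μ := volume) (0 : ℝ)
    (integrable_exp_neg_mul_sq (b := 1 / 2) (by norm_num)).integrableOn tendsto_id
  rw [integral_gaussian_Ioi] at h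
  have h' := h.const_sub (√(Real.pi / (1 / 2)) / 2)
  rw [sub_self] at h'
  exact h'

/-- Both Mills ratio inequalities reduce to this: the difference of the two sides vanishes at
infinity and has an explicit derivative of constant sign. -/
lemma nonneg_of_hasDerivAt_nonpos_of_tendsto_zero {f f' : ℝ → ℝ}
    (hf : ∀ x, 0 < x → HasDerivAt f (f' x) x) (hf' : ∀ x, 0 < x → f' x ≤ 0)
    (hlim : Tendsto f atTop (𝓝 0)) {x : ℝ} (hx : 0 < x) : 0 ≤ f x := by
  have hanti : AntitoneOn f (Set.Ici x) := by
    refine antitoneOn_of_deriv_nonpos (convex_Ici x)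
      (fun y hy => (hf y (hx.trans_le hy)).continuousAt.continuousWithinAt)
      (fun y hy => ?_) (fun y hy => ?_)
    all_goals rw [interior_Ici] at hy
    · exact (hf y (hx.trans hy)).differentiableAt.differentiableWithinAt
    · rw [(hf y (hx.trans hy)).deriv]
      exact hf' y (hx.trans hy)
  refine le_of_tendsto hlim ?_
  filter_upwards [eventually_ge_atTop x] with y hy
  exact hanti Set.self_mem_Ici hy hy

lemma tendsto_exp_neg_half_sq :
    Tendsto (fun x : ℝ => Real.exp (-(1 / 2) * x ^ 2)) atTop (𝓝 0) := by
  refine Real.tendsto_exp_atBot.comp ?_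
  exact (tendsto_pow_atTop (two_ne_zero)).const_mul_atTop_of_neg (by norm_num)

lemma hasDerivAt_exp_neg_half_sq (x : ℝ) :
    HasDerivAt (fun x : ℝ => Real.exp (-(1 / 2) * x ^ 2))
      (-x * Real.exp (-(1 / 2) * x ^ 2)) x := by
  have h := ((hasDerivAt_pow 2 x).const_mul (-(1 / 2 : ℝ))).exp
  refine h.congr_deriv ?_
  norm_num
  ring

lemma gaussTail_pos_nonneg {x : ℝ} (hx : 0 < x) : 0 ≤ gaussTail x :=
  nonneg_of_hasDerivAt_nonpos_of_tendsto_zero (fun x _ => hasDerivAt_gaussTail x)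
    (fun x _ => by simpa using (Real.exp_pos _).le) tendsto_gaussTail hx

lemma gaussTail_le {x : ℝ} (hx : 0 < x) :
    x * gaussTail x ≤ Real.exp (-(1 / 2) * x ^ 2) := by
  have key : 0 ≤ Real.exp (-(1 / 2) * x ^ 2) * x⁻¹ - gaussTail x := by
    refine nonneg_of_hasDerivAt_nonpos_of_tendsto_zero
      (f := fun x => Real.exp (-(1 / 2) * x ^ 2) * x⁻¹ - gaussTail x)
      (f' := fun x => -(Real.exp (-(1 / 2) * x ^ 2) / x ^ 2)) (fun y hy => ?_) (fun y hy => ?_)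
      ?_ hx
    · have h := ((hasDerivAt_exp_neg_half_sq y).mul (hasDerivAt_inv hy.ne')).sub
        (hasDerivAt_gaussTail y)
      refine h.congr_deriv ?_
      field_simp
      ring
    · simp only [neg_nonpos]; positivity
    · simpa using (tendsto_exp_neg_half_sq.mul tendsto_inv_atTop_zero).sub tendsto_gaussTail
  have h2 : x * (Real.exp (-(1 / 2) * x ^ 2) * x⁻¹ - gaussTail x) =
      Real.exp (-(1 / 2) * x ^ 2) - x * gaussTail x := by field_simp
  have := mul_nonneg hx.le key
  linarith

lemma le_gaussTail {x : ℝ} (hx : 0 < x) :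
    x * Real.exp (-(1 / 2) * x ^ 2) ≤ (1 + x ^ 2) * gaussTail x := by
  have key : 0 ≤ gaussTail x - x / (1 + x ^ 2) * Real.exp (-(1 / 2) * x ^ 2) := by
    refine nonneg_of_hasDerivAt_nonpos_of_tendsto_zero
      (f := fun x => gaussTail x - x / (1 + x ^ 2) * Real.exp (-(1 / 2) * x ^ 2))
      (f' := fun x => -(2 * Real.exp (-(1 / 2) * x ^ 2) / (1 + x ^ 2) ^ 2))
      (fun y hy => ?_) (fun y hy => ?_) ?_ hx
    · have hd : HasDerivAt (fun x : ℝ => 1 + x ^ 2) (2 * y) y := by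
        simpa using (hasDerivAt_pow 2 y).const_add 1
      have h := (hasDerivAt_gaussTail y).sub
        (((hasDerivAt_id y).div hd (by positivity)).mul (hasDerivAt_exp_neg_half_sq y))
      refine h.congr_deriv ?_
      have : (1 + y ^ 2) ≠ 0 := by positivity
      simp only [id, Pi.div_apply]
      field_simp
      ring
    · simp only [neg_nonpos]; positivity
    · have h0 : Tendsto (fun x : ℝ => x / (1 + x ^ 2) * Real.exp (-(1 / 2) * x ^ 2))
          atTop (𝓝 0) := by
        refine squeeze_zero' ?_ ?_ tendsto_exp_neg_half_sq
        · filter_upwards [eventually_ge_atTop 0] with y hy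
          positivity
        · filter_upwards [eventually_ge_atTop 0] with y hy
          refine mul_le_of_le_one_left (Real.exp_pos _).le ?_
          rw [div_le_one (by positivity)]
          nlinarith
      simpa using tendsto_gaussTail.sub h0
  have hp : 0 < 1 + x ^ 2 := by positivity
  have h2 : (1 + x ^ 2) * (gaussTail x - x / (1 + x ^ 2) * Real.exp (-(1 / 2) * x ^ 2)) =
      (1 + x ^ 2) * gaussTail x - x * Real.exp (-(1 / 2) * x ^ 2) := by field_simp
  have := mul_nonneg hp.le key
  linarith

lemma exp_half_mul_exp_neg_half (x : ℝ) :
    Real.exp (1 / 2 * x ^ 2) * Real.exp (-(1 / 2) * x ^ 2) = 1 := by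
  rw [← Real.exp_add]; simp

/-- The Mills ratio of the standard Gaussian. -/
noncomputable def mills (x : ℝ) : ℝ := Real.exp (1 / 2 * x ^ 2) * gaussTail x

lemma hasDerivAt_mills (x : ℝ) : HasDerivAt mills (x * mills x - 1) x := by
  have h1 : HasDerivAt (fun x : ℝ => Real.exp (1 / 2 * x ^ 2))
      (x * Real.exp (1 / 2 * x ^ 2)) x := by
    have h := ((hasDerivAt_pow 2 x).const_mul (1 / 2 : ℝ)).exp
    refine h.congr_deriv ?_
    norm_num
    ring
  have h := h1.mul (hasDerivAt_gaussTail x)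
  refine h.congr_deriv ?_
  have := exp_half_mul_exp_neg_half x
  unfold mills
  linear_combination -this

lemma mills_nonneg {x : ℝ} (hx : 0 < x) : 0 ≤ mills x :=
  mul_nonneg (Real.exp_pos _).le (gaussTail_pos_nonneg hx)

lemma mul_mills_le_one {x : ℝ} (hx : 0 < x) : x * mills x ≤ 1 := by
  have := mul_le_mul_of_nonneg_left (gaussTail_le hx) (Real.exp_pos (1 / 2 * x ^ 2)).le
  rw [exp_half_mul_exp_neg_half] at this
  unfold mills
  linarith

lemma le_mul_mills {x : ℝ} (hx : 0 < x) : x ≤ (1 + x ^ 2) * mills x := by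
  have := mul_le_mul_of_nonneg_left (le_gaussTail hx) (Real.exp_pos (1 / 2 * x ^ 2)).le
  have h := exp_half_mul_exp_neg_half x
  unfold mills
  linear_combination this - x * h

lemma mills_zero_le : mills 0 ≤ 2 := by
  have h : √(Real.pi / (1 / 2)) ≤ 4 := by
    rw [Real.sqrt_le_left (by norm_num)]
    linarith [Real.pi_le_four]
  simp only [mills, gaussTail, intervalIntegral.integral_same]
  norm_num at h ⊢
  linarith

lemma continuous_mills : Continuous mills :=
  continuous_iff_continuousAt.2 fun x => (hasDerivAt_mills x).continuousAt

lemma mills_le_two {x : ℝ} (hx : 0 ≤ x) : mills x ≤ 2 := by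
  have hanti : AntitoneOn mills (Set.Ici 0) := by
    refine antitoneOn_of_deriv_nonpos (convex_Ici 0) continuous_mills.continuousOn
      (fun y _ => (hasDerivAt_mills y).differentiableAt.differentiableWithinAt) (fun y hy => ?_)
    rw [interior_Ici] at hy
    rw [(hasDerivAt_mills y).deriv]
    linarith [mul_mills_le_one hy]
  exact (hanti Set.self_mem_Ici hx hx).trans mills_zero_le

/-- The bounded solution of the Stein equation `f' w = w * f w + 1{w ≤ 0} - 1 / 2`. -/
noncomputable def steinSol (w : ℝ) : ℝ := mills |w| / 2

lemma steinSol_neg (w : ℝ) : steinSol (-w) = steinSol w := by simp [steinSol]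

lemma steinSol_of_nonneg {w : ℝ} (hw : 0 ≤ w) : steinSol w = mills w / 2 := by
  rw [steinSol, abs_of_nonneg hw]

lemma mills_nonneg' {x : ℝ} (hx : 0 ≤ x) : 0 ≤ mills x := by
  rcases hx.eq_or_lt with rfl | hx
  · simp [mills, gaussTail]; positivity
  · exact mills_nonneg hx

lemma steinSol_nonneg (w : ℝ) : 0 ≤ steinSol w :=
  div_nonneg (mills_nonneg' (abs_nonneg w)) zero_le_two

lemma steinSol_le_one (w : ℝ) : steinSol w ≤ 1 := by
  have := mills_le_two (abs_nonneg w)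
  unfold steinSol
  linarith

lemma abs_mul_steinSol_le (w : ℝ) : |w * steinSol w| ≤ 1 / 2 := by
  rw [abs_mul, abs_of_nonneg (steinSol_nonneg w), steinSol]
  rcases (abs_nonneg w).eq_or_lt with h | h
  · rw [← h]; norm_num
  · linarith [mul_mills_le_one h]

lemma hasDerivAt_mul_mills (x : ℝ) :
    HasDerivAt (fun x => x * mills x) (mills x + x * (x * mills x - 1)) x := by
  exact ((hasDerivAt_id x).mul (hasDerivAt_mills x)).congr_deriv (by simp)

lemma mul_steinSol_sub_of_nonneg {a b : ℝ} (ha : 0 ≤ a) (hab : a ≤ b) :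
    0 ≤ b * steinSol b - a * steinSol a ∧ b * steinSol b - a * steinSol a ≤ b - a := by
  rw [steinSol_of_nonneg ha, steinSol_of_nonneg (ha.trans hab)]
  rcases hab.eq_or_lt with rfl | hab
  · simp
  obtain ⟨c, hc, h⟩ := exists_hasDerivAt_eq_slope (fun x => x * mills x)
    (fun x => mills x + x * (x * mills x - 1)) hab
    (continuous_id.mul continuous_mills).continuousOn (fun x _ => hasDerivAt_mul_mills x)
  have hc0 : 0 < c := ha.trans_lt hc.1
  have hba : 0 < b - a := sub_pos.2 hab
  rw [eq_div_iff hba.ne'] at h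
  have h1 : 0 ≤ mills c + c * (c * mills c - 1) := by
    linarith [le_mul_mills hc0]
  have h2 : mills c + c * (c * mills c - 1) ≤ 2 := by
    nlinarith [mul_mills_le_one hc0, mills_le_two hc0.le]
  constructor <;> nlinarith

/-- The map `w ↦ w * steinSol w` is odd, so the half-line suffices. There its slope is half of `(1 +
x ^ 2) * mills x - x`, nonnegative by the lower Mills bound and at most `1` because `x * mills x ≤
1` and `mills x ≤ 2`. -/
lemma mul_steinSol_sub {a b : ℝ} (hab : a ≤ b) :
    0 ≤ b * steinSol b - a * steinSol a ∧ b * steinSol b - a * steinSol a ≤ b - a := by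
  rcases le_total 0 a with ha | ha
  · exact mul_steinSol_sub_of_nonneg ha hab
  have h1 := mul_steinSol_sub_of_nonneg le_rfl (neg_nonneg.2 ha)
  rw [steinSol_neg a] at h1
  rcases le_total 0 b with hb | hb
  · have h2 := mul_steinSol_sub_of_nonneg le_rfl hb
    constructor <;> linarith [h1.1, h1.2, h2.1, h2.2]
  · have h2 := mul_steinSol_sub_of_nonneg (neg_nonneg.2 hb) (neg_le_neg hab)
    rw [steinSol_neg, steinSol_neg] at h2
    constructor <;> linarith [h2.1, h2.2]

lemma mul_steinSol_le_add {s c η : ℝ} (h : |c - s| ≤ η) :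
    s * steinSol s ≤ c * steinSol c + η := by
  rcases le_total s c with hsc | hsc
  · have := mul_steinSol_sub hsc
    linarith [this.1, (abs_nonneg (c - s)).trans h]
  · have := mul_steinSol_sub hsc
    rw [abs_sub_comm, abs_of_nonneg (sub_nonneg.2 hsc)] at h
    linarith [this.2]

lemma exists_steinSol_sub {a b : ℝ} (ha : 0 ≤ a) (hab : a < b) :
    ∃ s ∈ Set.Ioo a b, steinSol b - steinSol a = (b - a) * (s * steinSol s - 1 / 2) := by
  obtain ⟨s, hs, h⟩ := exists_hasDerivAt_eq_slope mills (fun x => x * mills x - 1) hab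
    continuous_mills.continuousOn (fun x _ => hasDerivAt_mills x)
  refine ⟨s, hs, ?_⟩
  rw [steinSol_of_nonneg ha, steinSol_of_nonneg (ha.trans hab.le),
    steinSol_of_nonneg (ha.trans hs.1.le)]
  rw [eq_div_iff (sub_pos.2 hab).ne'] at h
  linarith

/-- By the mean value theorem and the Stein equation the slope is `s * steinSol s - 1 / 2` at an
intermediate `s`; replacing `s` by `c` costs at most `η`, by the Lipschitz bound. -/
lemma steinSol_sub_le_of_nonneg {a b c η : ℝ} (ha : 0 ≤ a) (hab : a ≤ b)
    (hc : ∀ s ∈ Set.Icc a b, |c - s| ≤ η) :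
    steinSol b - steinSol a ≤ (b - a) * (c * steinSol c + η - 1 / 2) := by
  rcases hab.eq_or_lt with rfl | hab
  · simp
  obtain ⟨s, hs, h⟩ := exists_steinSol_sub ha hab
  rw [h]
  exact mul_le_mul_of_nonneg_left
    (by linarith [mul_steinSol_le_add (hc s ⟨hs.1.le, hs.2.le⟩)]) (sub_nonneg.2 hab.le)

lemma steinSol_sub_le_of_nonpos {a b c η : ℝ} (hb : b ≤ 0) (hab : a ≤ b)
    (hc : ∀ s ∈ Set.Icc a b, |c - s| ≤ η) :
    steinSol b - steinSol a ≤ (b - a) * (c * steinSol c + η + 1 / 2) := by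
  rcases hab.eq_or_lt with rfl | hab
  · simp
  obtain ⟨s, hs, h⟩ := exists_steinSol_sub (neg_nonneg.2 hb) (neg_lt_neg hab)
  rw [steinSol_neg, steinSol_neg] at h
  have hs' := mul_steinSol_le_add (hc (-s) ⟨by linarith [hs.2], by linarith [hs.1]⟩)
  rw [steinSol_neg] at hs'
  have h' : steinSol b - steinSol a = (b - a) * (-s * steinSol s + 1 / 2) := by
    linear_combination -h
  rw [h']
  exact mul_le_mul_of_nonneg_left (by linarith) (sub_nonneg.2 hab.le)

/-- One-sided increment bound for the Stein solution on an interval of points within `η` of `c`. -/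
lemma steinSol_sub_le {a b c η : ℝ} (hab : a ≤ b) (hc : ∀ s ∈ Set.Icc a b, |c - s| ≤ η) :
    steinSol b - steinSol a ≤
      (b - a) * (c * steinSol c + η + (if c ≤ η then 1 else 0) - 1 / 2) := by
  have hle : ∀ s ∈ Set.Icc a b, s ≤ 0 → c ≤ η := fun s hs h0 => by
    linarith [le_abs_self (c - s), hc s hs]
  rcases le_or_gt 0 a with ha | ha
  · refine (steinSol_sub_le_of_nonneg ha hab hc).trans
      (mul_le_mul_of_nonneg_left ?_ (sub_nonneg.2 hab))
    split_ifs <;> linarith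
  rw [if_pos (hle a ⟨le_rfl, hab⟩ ha.le)]
  rcases le_or_gt b 0 with hb | hb
  · exact (steinSol_sub_le_of_nonpos hb hab hc).trans
      (mul_le_mul_of_nonneg_left (by linarith) (sub_nonneg.2 hab))
  -- The solution has a kink at `0`, so an interval straddling it is cut there.
  · have h1 := steinSol_sub_le_of_nonpos (c := c) (η := η) le_rfl ha.le
      (fun s hs => hc s ⟨hs.1, hs.2.trans hb.le⟩)
    have h2 := steinSol_sub_le_of_nonneg (c := c) (η := η) le_rfl hb.le
      (fun s hs => hc s ⟨ha.le.trans hs.1, hs.2⟩)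
    linarith

/-- The evaluation point is shifted to `w + b` so that everything within `b` of it lies to the right
of `w`. The jump of the derivative is then felt only if `w ≤ 0`, and the indicator comes out
unsmoothed. -/
lemma mul_steinSol_increment_le (w ξ b : ℝ) (hξ : |ξ| ≤ b) :
    ξ * (steinSol (w + b) - steinSol (w + b - ξ)) ≤
      ξ ^ 2 * ((w + b) * steinSol (w + b) + b + (if w ≤ 0 then 1 else 0) - 1 / 2) := by
  have hif : (if w + b ≤ b then (1 : ℝ) else 0) = if w ≤ 0 then 1 else 0 := by simp
  rw [← hif]
  obtain ⟨h1, h2⟩ := abs_le.1 hξ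
  rcases le_total 0 ξ with h | h
  · have := steinSol_sub_le (a := w + b - ξ) (b := w + b) (c := w + b) (η := b) (by linarith)
      (fun s hs => abs_le.2 ⟨by linarith [hs.2], by linarith [hs.1]⟩)
    nlinarith [mul_le_mul_of_nonneg_left this h]
  · have := steinSol_sub_le (a := w + b) (b := w + b - ξ) (c := w + b) (η := b) (by linarith)
      (fun s hs => abs_le.2 ⟨by linarith [hs.2], by linarith [hs.1]⟩)
    nlinarith [mul_le_mul_of_nonneg_left this (neg_nonneg.2 h)]

/-! ### A Berry–Esseen bound at the origin -/

section BerryEsseen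

open ProbabilityTheory

variable {Ω : Type*} [Finite Ω] [MeasurableSpace Ω] [MeasurableSingletonClass Ω]

/-- Stein's method: a sum of bounded centred independent random variables is nonpositive with
probability at least `1 / 2`, up to the size of the variables and the fluctuation of the sum
of squares. -/
lemma half_sub_le_measureReal_sum_nonpos {ι : Type*} [Fintype ι] {P : Measure Ω}
    [IsProbabilityMeasure P] {ξ : ι → Ω → ℝ} (hind : iIndepFun ξ P) {b : ℝ}
    (hb : ∀ i ω, |ξ i ω| ≤ b) (hb0 : 0 ≤ b) (hmean : ∀ i, ∫ ω, ξ i ω ∂P = 0) :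
    1 / 2 - 2 * b - (1 + b) * ∫ ω, |∑ i, ξ i ω ^ 2 - 1| ∂P
      ≤ P.real {ω | ∑ i, ξ i ω ≤ 0} := by
  classical
  set W : Ω → ℝ := fun ω => ∑ i, ξ i ω with hW
  set V : Ω → ℝ := fun ω => ∑ i, ξ i ω ^ 2 with hV
  set H : Ω → ℝ := fun ω => (W ω + b) * steinSol (W ω + b) with hH
  -- An upper bound for the slope of the Stein solution near `W + b`, read off from the Stein
  -- equation.
  set G : Ω → ℝ := fun ω => H ω + b + (if W ω ≤ 0 then 1 else 0) - 1 / 2 with hG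
  have hint : ∀ f : Ω → ℝ, Integrable f P := fun f => .of_finite
  have hstein : ∫ ω, W ω * steinSol (W ω + b) ∂P
      = ∫ ω, ∑ i, ξ i ω * (steinSol (W ω + b) - steinSol (W ω + b - ξ i ω)) ∂P := by
    -- Removing `ξ i` from `W` leaves a variable independent of the centred `ξ i`.
    have hzero : ∀ i, ∫ ω, ξ i ω * steinSol (W ω + b - ξ i ω) ∂P = 0 := by
      intro i
      have h1 : IndepFun (ξ i) (∑ j ∈ Finset.univ.erase i, ξ j) P :=
        (hind.indepFun_finsetSum_of_notMem (fun _ => .of_discrete)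
          (Finset.notMem_erase i _)).symm
      have hg : Measurable fun x : ℝ => steinSol (x + b) := by
        have : Continuous fun x : ℝ => steinSol (x + b) :=
          (continuous_mills.comp (by fun_prop)).div_const 2
        exact this.measurable
      have h2 := (h1.comp measurable_id hg).integral_mul_eq_mul_integral
        Measurable.of_discrete.aestronglyMeasurable Measurable.of_discrete.aestronglyMeasurable
      have h3 : ∀ ω, steinSol (W ω + b - ξ i ω)
          = steinSol ((∑ j ∈ Finset.univ.erase i, ξ j) ω + b) := fun ω => by
        rw [Finset.sum_apply]
        congr 1
        simp only [hW]
        rw [← Finset.sum_erase_add _ _ (Finset.mem_univ i)]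
        ring
      simp_rw [h3]
      simpa [hmean i] using h2
    have : ∀ ω, W ω * steinSol (W ω + b)
        = ∑ i, ξ i ω * (steinSol (W ω + b) - steinSol (W ω + b - ξ i ω))
          + ∑ i, ξ i ω * steinSol (W ω + b - ξ i ω) := fun ω => by
      rw [← Finset.sum_add_distrib, hW, Finset.sum_mul]
      exact Finset.sum_congr rfl fun i _ => by ring
    simp_rw [this]
    rw [integral_add (hint _) (hint _), add_eq_left, integral_finsetSum _ fun i _ => hint _]
    exact Finset.sum_eq_zero fun i _ => hzero i
  have hpt : ∀ ω, ∑ i, ξ i ω * (steinSol (W ω + b) - steinSol (W ω + b - ξ i ω))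
      ≤ G ω + (1 + b) * |V ω - 1| := by
    intro ω
    have h1 : ∑ i, ξ i ω * (steinSol (W ω + b) - steinSol (W ω + b - ξ i ω)) ≤ V ω * G ω := by
      rw [hV, Finset.sum_mul]
      exact Finset.sum_le_sum fun i _ => mul_steinSol_increment_le _ _ _ (hb i ω)
    have h2 : |G ω| ≤ 1 + b := by
      have := abs_le.1 (abs_mul_steinSol_le (W ω + b))
      rw [abs_le]
      simp only [hG, hH]
      split_ifs <;> constructor <;> linarith [this.1, this.2]
    have h3 : (V ω - 1) * G ω ≤ |V ω - 1| * (1 + b) :=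
      (le_abs_self _).trans (by rw [abs_mul]; gcongr)
    linarith
  have hPW : P.real {ω | W ω ≤ 0} = ∫ ω, (if W ω ≤ 0 then 1 else 0 : ℝ) ∂P := by
    rw [← integral_indicator_one (Set.Finite.measurableSet (Set.toFinite _))]
    rfl
  have hmono := integral_mono (hint _) (hint _) hpt
  rw [← hstein] at hmono
  have hsplit : ∀ ω, W ω * steinSol (W ω + b) = H ω - b * steinSol (W ω + b) := fun ω => by
    simp only [hH]; ring
  simp_rw [hsplit] at hmono
  have hF : ∫ ω, steinSol (W ω + b) ∂P ≤ 1 := by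
    have := integral_mono (hint _) (hint _) (fun ω => steinSol_le_one (W ω + b)) (μ := P)
    simpa using this
  rw [integral_sub (hint _) (hint _), integral_add (hint _) (hint _), integral_const_mul,
    integral_const_mul] at hmono
  simp only [hG] at hmono
  rw [integral_sub (hint _) (hint _), integral_add (hint _) (hint _),
    integral_add (hint _) (hint _), ← hPW] at hmono
  simp only [integral_const, probReal_univ, smul_eq_mul] at hmono
  -- The integral of `H` cancels. One `b` comes from the slope bound `G`, the other from `W = (W +
  -- b) - b` with `steinSol ≤ 1`.
  nlinarith [mul_le_mul_of_nonneg_left hF hb0]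

instance isProbabilityMeasure_iidLaw {X : Type*} [MeasurableSpace X] (P : Measure X)
    [IsProbabilityMeasure P] (n : ℕ) : IsProbabilityMeasure (iidLaw P n) := by
  unfold iidLaw
  infer_instance

/-- The variance of a sum of i.i.d. variables. -/
lemma variance_sum_iidLaw (Q : Measure Ω) [IsProbabilityMeasure Q] (h : Ω → ℝ) (n : ℕ) :
    Var[fun z : Fin n → Ω => ∑ i, h (z i); iidLaw Q n] = n * Var[h; Q] := by
  have := variance_sum_pi (μ := fun _ : Fin n => Q) (X := fun _ => h)
    (fun _ => .of_discrete)
  simp only [Finset.sum_const, Finset.card_univ, Fintype.card_fin, nsmul_eq_mul] at this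
  rw [← this, iidLaw]
  congr 1
  ext z
  simp

lemma integral_sum_iidLaw (Q : Measure Ω) [IsProbabilityMeasure Q] (h : Ω → ℝ) (n : ℕ) :
    ∫ z, ∑ i, h (z i) ∂(iidLaw Q n) = n * ∫ x, h x ∂Q := by
  rw [integral_finsetSum _ fun i _ => .of_finite]
  have : ∀ i : Fin n, ∫ z, h (z i) ∂(iidLaw Q n) = ∫ x, h x ∂Q := fun i =>
    integral_comp_eval (μ := fun _ : Fin n => Q) (i := i)
      Measurable.of_discrete.aestronglyMeasurable
  simp [this]

/-- Nonnegativity of the variance of the absolute deviation. -/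
lemma integral_abs_sub_integral_le_sqrt_variance (P : Measure Ω) [IsProbabilityMeasure P]
    (X : Ω → ℝ) : ∫ ω, |X ω - ∫ ω', X ω' ∂P| ∂P ≤ √(Var[X; P]) := by
  apply Real.le_sqrt_of_sq_le
  have h := variance_nonneg (fun ω => |X ω - ∫ ω', X ω' ∂P|) P
  rw [variance_eq_sub .of_discrete] at h
  rw [variance_eq_integral Measurable.of_discrete.aemeasurable]
  simpa [sq_abs] using sub_nonneg.1 h

/-- For i.i.d. variables on a finite alphabet, the empirical mean is at most any number above the
expectation with probability at least `1 / 2 - O(1 / √n)`. -/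
lemma exists_half_sub_le_iidLaw (Q : Measure Ω) [IsProbabilityMeasure Q] (g : Ω → ℝ) {c : ℝ}
    (hc : ∫ x, g x ∂Q ≤ c) :
    ∃ C : ℝ, ∀ n : ℕ, 0 < n →
      1 / 2 - C / √n ≤ (iidLaw Q n).real {z | 1 / (n : ℝ) * ∑ i, g (z i) ≤ c} := by
  set g₀ : Ω → ℝ := fun x => g x - ∫ x, g x ∂Q with hg₀
  have hmean : ∫ x, g₀ x ∂Q = 0 := by
    rw [hg₀, integral_sub .of_finite .of_finite]; simp
  have hsub : ∀ n : ℕ, 0 < n → {z : Fin n → Ω | ∑ i, g₀ (z i) ≤ 0} ⊆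
      {z | 1 / (n : ℝ) * ∑ i, g (z i) ≤ c} := by
    intro n hn z hz
    simp only [hg₀, Finset.sum_sub_distrib, Finset.sum_const, Finset.card_univ, Fintype.card_fin,
      nsmul_eq_mul, Set.mem_ofPred_eq] at hz ⊢
    have hn' : (0 : ℝ) < n := by exact_mod_cast hn
    rw [one_div, inv_mul_le_iff₀ hn']
    nlinarith
  suffices ∃ C : ℝ, ∀ n : ℕ, 0 < n →
      1 / 2 - C / √n ≤ (iidLaw Q n).real {z | ∑ i, g₀ (z i) ≤ 0} by
    obtain ⟨C, hC⟩ := this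
    exact ⟨C, fun n hn => (hC n hn).trans (measureReal_mono (hsub n hn))⟩
  clear_value g₀
  set v : ℝ := ∫ x, g₀ x ^ 2 ∂Q with hv
  have hv0 : 0 ≤ v := integral_nonneg fun x => sq_nonneg _
  rcases hv0.eq_or_lt with hv0 | hv0
  -- Zero variance admits no normalisation, but then every summand vanishes almost surely.
  · refine ⟨0, fun n hn => ?_⟩
    have h0 : ∀ᵐ x ∂Q, g₀ x = 0 := by
      have := (integral_eq_zero_iff_of_nonneg (fun x => sq_nonneg (g₀ x)) .of_finite).1 hv0.symm
      filter_upwards [this] with x hx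
      simpa using hx
    have h1 : ∀ᵐ z ∂(iidLaw Q n), ∑ i, g₀ (z i) ≤ 0 := by
      have : ∀ᵐ z ∂(iidLaw Q n), ∀ i, g₀ (z i) = 0 := by
        rw [ae_all_iff]
        exact fun i => (measurePreserving_eval (fun _ : Fin n => Q) i).quasiMeasurePreserving.ae h0
      filter_upwards [this] with z hz
      simp [hz]
    have h2 : (iidLaw Q n).real {z | ∑ i, g₀ (z i) ≤ 0} = 1 := by
      rw [measureReal_def, (prob_compl_eq_zero_iff (Set.toFinite _).measurableSet).1 h1]
      simp
    rw [h2]; norm_num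
  obtain ⟨B, hB⟩ : ∃ B : ℝ, ∀ x, |g₀ x| ≤ B := by
    obtain ⟨B, hB⟩ := (Set.finite_range fun x => |g₀ x|).bddAbove
    exact ⟨B, fun x => hB ⟨x, rfl⟩⟩
  have hB0 : 0 ≤ B := by
    obtain ⟨x⟩ := Q.nonempty_of_neZero
    exact (abs_nonneg _).trans (hB x)
  set σ := √v with hσ
  have hσ0 : 0 < σ := Real.sqrt_pos.2 hv0
  have hσv : σ ^ 2 = v := Real.sq_sqrt hv0.le
  set K := √(Var[fun x => g₀ x ^ 2; Q]) / v with hK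
  have hK0 : 0 ≤ K := by positivity
  -- The summands `g₀ / (σ * √n)` are bounded by `b = B / (σ * √n)`, their squares fluctuate by at
  -- most `K / √n` in mean, and the factor `1 + b` is at most `1 + B / σ`.
  refine ⟨2 * (B / σ) + (1 + B / σ) * K, fun n hn => ?_⟩
  have hn' : (1 : ℝ) ≤ n := by exact_mod_cast hn
  have hs1 : 1 ≤ √(n : ℝ) := Real.one_le_sqrt.2 hn'
  have hs0 : 0 < √(n : ℝ) := by linarith
  have hsq : √(n : ℝ) ^ 2 = n := Real.sq_sqrt (by linarith)
  set b := B / (σ * √n) with hbdef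
  have hind : iIndepFun (fun (i : Fin n) (z : Fin n → Ω) => g₀ (z i) / (σ * √n)) (iidLaw Q n) :=
    iIndepFun_pi (μ := fun _ : Fin n => Q) (X := fun _ x => g₀ x / (σ * √n))
      fun _ => Measurable.of_discrete.aemeasurable
  have hmain := half_sub_le_measureReal_sum_nonpos hind (b := b)
    (fun i z => by
      rw [abs_div, abs_of_pos (mul_pos hσ0 hs0)]
      exact div_le_div_of_nonneg_right (hB _) (by positivity)) (by positivity)
    (fun i => by
      rw [integral_div]
      have : ∫ z, g₀ (z i) ∂(iidLaw Q n) = ∫ x, g₀ x ∂Q :=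
        integral_comp_eval (μ := fun _ : Fin n => Q) (i := i)
          Measurable.of_discrete.aestronglyMeasurable
      rw [this, hmean, zero_div])
  have hset : {z : Fin n → Ω | ∑ i, g₀ (z i) / (σ * √n) ≤ 0} = {z | ∑ i, g₀ (z i) ≤ 0} := by
    ext z
    simp only [Set.mem_ofPred_eq, ← Finset.sum_div]
    rw [div_le_iff₀ (by positivity), zero_mul]
  rw [hset] at hmain
  have hfluct : ∫ z, |∑ i, (g₀ (z i) / (σ * √n)) ^ 2 - 1| ∂(iidLaw Q n) ≤ K / √n := by
    have h1 := integral_abs_sub_integral_le_sqrt_variance (iidLaw Q n)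
      (fun z => ∑ i, g₀ (z i) ^ 2)
    rw [integral_sum_iidLaw Q (fun x => g₀ x ^ 2), variance_sum_iidLaw Q (fun x => g₀ x ^ 2),
      ← hv, Real.sqrt_mul (by linarith)] at h1
    have h2 : ∀ z : Fin n → Ω, |∑ i, (g₀ (z i) / (σ * √n)) ^ 2 - 1|
        = |∑ i, g₀ (z i) ^ 2 - n * v| / (n * v) := fun z => by
      have hnv : 0 < n * v := by positivity
      simp only [div_pow, mul_pow, hsq, hσv, ← Finset.sum_div]
      rw [← abs_of_pos hnv, ← abs_div, abs_of_pos hnv]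
      congr 1
      field_simp
    simp_rw [h2]
    rw [integral_div, div_le_iff₀ (by positivity)]
    refine h1.trans (le_of_eq ?_)
    rw [hK]
    field_simp
    rw [hsq, mul_comm]
  have hb' : b = B / σ / √n := by rw [hbdef, div_div]
  have hb1 : b ≤ B / σ := by
    rw [hb']; exact div_le_self (by positivity) hs1
  have h3 : (1 + b) * ∫ z, |∑ i, (g₀ (z i) / (σ * √n)) ^ 2 - 1| ∂(iidLaw Q n)
      ≤ (1 + B / σ) * (K / √n) := by
    refine mul_le_mul (by linarith) hfluct (integral_nonneg fun _ => abs_nonneg _) (by positivity)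
  have h4 : (2 * (B / σ) + (1 + B / σ) * K) / √n = 2 * b + (1 + B / σ) * (K / √n) := by
    rw [hb']; ring
  rw [h4]
  linarith

end BerryEsseen

/-! ### Couplings and excess-distance probabilities -/

section Couplings

variable {α β : Type*} [MeasurableSpace α] [MeasurableSpace β] {μ : Measure α} {ν : Measure β}

lemma couplings_nonempty (μ : Measure α) (ν : Measure β) [IsProbabilityMeasure μ]
    [IsProbabilityMeasure ν] : (couplings μ ν).Nonempty :=
  ⟨μ.prod ν, inferInstance, Measure.fst_prod, Measure.snd_prod⟩

/-- Covers `r = 0` too, where the inverse is `∞` but the measure is zero. -/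
lemma inv_smul_smul_of_measure_univ_eq {r : ℝ≥0∞} (hμ : μ Set.univ = r) (hr : r ≠ ∞) :
    r⁻¹ • r • μ = μ := by
  by_cases h0 : r = 0
  · rw [h0, Measure.measure_univ_eq_zero] at hμ
    simp [hμ]
  · rw [smul_smul, ENNReal.inv_mul_cancel h0 hr, one_smul]

/-- A measure whose marginals are dominated by `μ` and `ν` is dominated by a coupling. -/
lemma exists_coupling_ge [IsProbabilityMeasure μ] [IsProbabilityMeasure ν]
    (σ : Measure (α × β)) (hfst : σ.fst ≤ μ) (hsnd : σ.snd ≤ ν) :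
    ∃ π ∈ couplings μ ν, σ ≤ π := by
  have hf1 : IsFiniteMeasure σ.fst := isFiniteMeasure_of_le μ hfst
  have hf2 : IsFiniteMeasure σ.snd := isFiniteMeasure_of_le ν hsnd
  set r : ℝ≥0∞ := 1 - σ Set.univ with hr
  have hμ : (μ - σ.fst) Set.univ = r := by
    rw [Measure.sub_apply .univ hfst, measure_univ, Measure.fst_univ]
  have hν : (ν - σ.snd) Set.univ = r := by
    rw [Measure.sub_apply .univ hsnd, measure_univ, Measure.snd_univ]
  have hr' : r ≠ ∞ := ne_top_of_le_ne_top ENNReal.one_ne_top tsub_le_self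
  have hfinμ : IsFiniteMeasure (μ - σ.fst) := ⟨by rw [hμ]; exact hr'.lt_top⟩
  have hfinν : IsFiniteMeasure (ν - σ.snd) := ⟨by rw [hν]; exact hr'.lt_top⟩
  -- The two marginal deficits have the same mass `r`; their normalised product supplies what is
  -- missing.
  set π : Measure (α × β) := σ + r⁻¹ • (μ - σ.fst).prod (ν - σ.snd) with hπ
  have h1 : π.fst = μ := by
    have : π.fst = σ.fst + r⁻¹ • r • (μ - σ.fst) := by
      rw [hπ, Measure.fst, Measure.map_add _ _ measurable_fst, Measure.map_smul,
        Measure.map_fst_prod, hν, Measure.fst]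
    rw [this, inv_smul_smul_of_measure_univ_eq hμ hr', add_comm, Measure.sub_add_cancel_of_le hfst]
  have h2 : π.snd = ν := by
    have : π.snd = σ.snd + r⁻¹ • r • (ν - σ.snd) := by
      rw [hπ, Measure.snd, Measure.map_add _ _ measurable_snd, Measure.map_smul,
        Measure.map_snd_prod, hμ, Measure.snd]
    rw [this, inv_smul_smul_of_measure_univ_eq hν hr', add_comm, Measure.sub_add_cancel_of_le hsnd]
  refine ⟨π, ⟨⟨?_⟩, h1, h2⟩, Measure.le_add_right le_rfl⟩
  rw [← Measure.fst_univ, h1, measure_univ]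

variable {δ : α → β → ℝ} {d : ℝ}

lemma bddBelow_excess : BddBelow
    ((fun π : Measure (α × β) => π.real {z | d < δ z.1 z.2}) '' couplings μ ν) :=
  ⟨0, by rintro _ ⟨π, -, rfl⟩; exact measureReal_nonneg⟩

lemma minExcessProb_le {π : Measure (α × β)} (hπ : π ∈ couplings μ ν) :
    minExcessProb δ d μ ν ≤ π.real {z | d < δ z.1 z.2} :=
  csInf_le bddBelow_excess ⟨π, hπ, rfl⟩

lemma minExcessProb_nonneg : 0 ≤ minExcessProb δ d μ ν :=
  Real.sInf_nonneg (by rintro _ ⟨π, -, rfl⟩; exact measureReal_nonneg)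

lemma measureReal_excess [DiscreteMeasurableSpace (α × β)] (π : Measure (α × β))
    [IsProbabilityMeasure π] :
    π.real {z | d < δ z.1 z.2} = 1 - π.real {z | δ z.1 z.2 ≤ d} := by
  rw [← probReal_compl_eq_one_sub .of_discrete]
  congr 1
  ext z
  simp

lemma measureReal_le_one_sub_minExcessProb [DiscreteMeasurableSpace (α × β)]
    {π : Measure (α × β)} (hπ : π ∈ couplings μ ν) :
    π.real {z | δ z.1 z.2 ≤ d} ≤ 1 - minExcessProb δ d μ ν := by
  have := hπ.1
  have h := minExcessProb_le (δ := δ) (d := d) hπ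
  rw [measureReal_excess] at h
  linarith

variable [IsProbabilityMeasure μ] [IsProbabilityMeasure ν]

lemma minExcessProb_le_one : minExcessProb δ d μ ν ≤ 1 := by
  obtain ⟨π, hπ⟩ := couplings_nonempty μ ν
  have := hπ.1
  exact (minExcessProb_le hπ).trans measureReal_le_one

lemma one_sub_minExcessProb_le [DiscreteMeasurableSpace (α × β)] {B : ℝ}
    (hB : ∀ π ∈ couplings μ ν, π.real {z | δ z.1 z.2 ≤ d} ≤ B) :
    1 - minExcessProb δ d μ ν ≤ B := by
  have : 1 - B ≤ minExcessProb δ d μ ν := by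
    refine le_csInf ((couplings_nonempty μ ν).image _) ?_
    rintro _ ⟨π, hπ, rfl⟩
    have := hπ.1
    have h := hB π hπ
    simp only
    rw [measureReal_excess]
    linarith
  linarith

end Couplings

/-! ### Powers of a single-letter coupling and Chernoff's bound -/

section IID

variable {X Y : Type*} [Finite X] [Finite Y] [MeasurableSpace X] [MeasurableSingletonClass X]
  [MeasurableSpace Y] [MeasurableSingletonClass Y]

/-- Split a sequence of pairs into a pair of sequences. -/
def splitPairs (n : ℕ) (z : Fin n → X × Y) : (Fin n → X) × (Fin n → Y) :=
  (fun i => (z i).1, fun i => (z i).2)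

/-- The joint law of `n` independent copies of a random pair with law `Q`. -/
noncomputable def iidJoint (Q : Measure (X × Y)) (n : ℕ) :
    Measure ((Fin n → X) × (Fin n → Y)) :=
  (iidLaw Q n).map (splitPairs n)

lemma iidLaw_map {Z W : Type*} [Finite Z] [MeasurableSpace Z] [MeasurableSingletonClass Z]
    [MeasurableSpace W] (Q : Measure Z) [IsProbabilityMeasure Q] (f : Z → W) (n : ℕ) :
    (iidLaw Q n).map (fun z i => f (z i)) = iidLaw (Q.map f) n := by
  have : IsProbabilityMeasure (Q.map f) :=
    Measure.isProbabilityMeasure_map Measurable.of_discrete.aemeasurable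
  exact Measure.pi_map_pi (μ := fun _ : Fin n => Q) (f := fun _ => f)
    fun _ => Measurable.of_discrete.aemeasurable

lemma iidJoint_fst (Q : Measure (X × Y)) [IsProbabilityMeasure Q] (n : ℕ) :
    (iidJoint Q n).fst = iidLaw Q.fst n := by
  rw [iidJoint, Measure.fst, Measure.map_map .of_discrete .of_discrete, Measure.fst,
    ← iidLaw_map]
  rfl

lemma iidJoint_snd (Q : Measure (X × Y)) [IsProbabilityMeasure Q] (n : ℕ) :
    (iidJoint Q n).snd = iidLaw Q.snd n := by
  rw [iidJoint, Measure.snd, Measure.map_map .of_discrete .of_discrete, Measure.snd,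
    ← iidLaw_map]
  rfl

instance isProbabilityMeasure_iidJoint (Q : Measure (X × Y)) [IsProbabilityMeasure Q] (n : ℕ) :
    IsProbabilityMeasure (iidJoint Q n) :=
  Measure.isProbabilityMeasure_map Measurable.of_discrete.aemeasurable

lemma iidJoint_mem_couplings {PX : Measure X} {PY : Measure Y} {Q : Measure (X × Y)}
    (hQ : Q ∈ couplings PX PY) (n : ℕ) :
    iidJoint Q n ∈ couplings (iidLaw PX n) (iidLaw PY n) := by
  obtain ⟨hp, rfl, rfl⟩ := hQ
  exact ⟨inferInstance, iidJoint_fst Q n, iidJoint_snd Q n⟩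

lemma iidJoint_real_apply (Q : Measure (X × Y)) (n : ℕ)
    (s : Set ((Fin n → X) × (Fin n → Y))) :
    (iidJoint Q n).real s = (iidLaw Q n).real (splitPairs n ⁻¹' s) :=
  map_measureReal_apply .of_discrete .of_discrete

/-- Chernoff's bound for the excess-distance probability of an i.i.d. coupling. -/
lemma minExcessProbIID_le_exp {PX : Measure X} {PY : Measure Y} {Q : Measure (X × Y)}
    (hQ : Q ∈ couplings PX PY) (δ : X → Y → ℝ) (d : ℝ) {t : ℝ} (ht : 0 ≤ t) {n : ℕ}
    (hn : 0 < n) :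
    minExcessProbIID δ d PX PY n
      ≤ Real.exp (-((t * d - Real.log (∫ z, Real.exp (t * δ z.1 z.2) ∂Q)) * n)) := by
  have := hQ.1
  refine (minExcessProb_le (iidJoint_mem_couplings hQ n)).trans ?_
  rw [iidJoint_real_apply]
  have hn' : (0 : ℝ) < n := by exact_mod_cast hn
  have hpos : 0 < ∫ z, Real.exp (t * δ z.1 z.2) ∂Q := integral_exp_pos .of_finite
  have hind : (iidLaw Q n).real (splitPairs n ⁻¹' {z | d < avgDist δ n z.1 z.2})
      ≤ ∫ z, Real.exp (-(t * d * n)) * ∏ i, Real.exp (t * δ (z i).1 (z i).2) ∂(iidLaw Q n) := by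
    rw [← integral_indicator_one .of_discrete]
    refine integral_mono .of_finite .of_finite fun z => ?_
    by_cases h : z ∈ splitPairs n ⁻¹' {z | d < avgDist δ n z.1 z.2}
    · rw [Set.indicator_of_mem h, Pi.one_apply, ← Real.exp_sum, ← Real.exp_add, Real.one_le_exp_iff, ← Finset.mul_sum]
      have h' : d * n ≤ ∑ i, δ (z i).1 (z i).2 := by
        have : d < 1 / (n : ℝ) * ∑ i, δ (z i).1 (z i).2 := h
        rw [one_div, lt_inv_mul_iff₀ hn'] at this
        linarith
      nlinarith
    · rw [Set.indicator_of_notMem h]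
      positivity
  refine hind.trans (le_of_eq ?_)
  rw [integral_const_mul, iidLaw,
    integral_fintype_prod_eq_pow (fun z : X × Y => Real.exp (t * δ z.1 z.2)), Fintype.card_fin,
    ← Real.exp_log (pow_pos hpos n), ← Real.exp_add, Real.log_pow]
  congr 1
  ring

end IID

/-! ### Relative entropy and types on a finite alphabet -/

section Types

variable {α : Type*} [Finite α] [MeasurableSpace α] [MeasurableSingletonClass α]

/-- The log-likelihood ratio of two distributions on a finite alphabet. -/
noncomputable def logRatio (Q P : Measure α) (a : α) : ℝ :=
  Real.log (Q.real {a} / P.real {a})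

lemma measureReal_singleton_pos_of_ac {Q P : Measure α} [IsFiniteMeasure Q] [IsFiniteMeasure P]
    (h : Q ≪ P) {a : α} (ha : 0 < Q.real {a}) : 0 < P.real {a} := by
  refine measureReal_nonneg.lt_of_ne fun h0 => ha.ne' ?_
  rw [eq_comm, measureReal_eq_zero_iff] at h0
  rw [measureReal_eq_zero_iff]
  exact h h0

lemma toReal_klDiv_eq_integral_logRatio {Q P : Measure α} [IsProbabilityMeasure Q]
    [IsProbabilityMeasure P] (h : Q ≪ P) :
    (klDiv Q P).toReal = ∫ a, logRatio Q P a ∂Q := by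
  rw [toReal_klDiv_of_measure_eq h (by simp)]
  refine integral_congr_ae ?_
  rw [Filter.EventuallyEq, ae_iff_of_countable]
  intro a ha
  have hP : P {a} ≠ 0 := fun h0 => ha (h h0)
  have h1 := Measure.setLIntegral_rnDeriv h {a}
  rw [lintegral_singleton] at h1
  have h2 : Q.rnDeriv P a = Q {a} / P {a} :=
    (ENNReal.eq_div_iff hP (measure_ne_top _ _)).2 (by rw [mul_comm, h1])
  rw [llr, h2, ENNReal.toReal_div]
  rfl

lemma klDiv_eq_ofReal_integral_logRatio {Q P : Measure α} [IsProbabilityMeasure Q]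
    [IsProbabilityMeasure P] (h : Q ≪ P) :
    klDiv Q P = ENNReal.ofReal (∫ a, logRatio Q P a ∂Q) := by
  rw [← toReal_klDiv_eq_integral_logRatio h,
    ENNReal.ofReal_toReal (klDiv_ne_top h .of_finite)]

lemma integral_logRatio_nonneg {Q P : Measure α} [IsProbabilityMeasure Q]
    [IsProbabilityMeasure P] (h : Q ≪ P) : 0 ≤ ∫ a, logRatio Q P a ∂Q := by
  rw [← toReal_klDiv_eq_integral_logRatio h]
  exact ENNReal.toReal_nonneg

lemma le_integral_logRatio {Q P : Measure α} [IsProbabilityMeasure Q] [IsProbabilityMeasure P]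
    (h : Q ≪ P) {e : ℝ} (he : ENNReal.ofReal e ≤ klDiv Q P) :
    e ≤ ∫ a, logRatio Q P a ∂Q := by
  rw [klDiv_eq_ofReal_integral_logRatio h] at he
  exact (ENNReal.ofReal_le_ofReal_iff (integral_logRatio_nonneg h)).1 he

lemma iidLaw_real_singleton (P : Measure α) [IsProbabilityMeasure P] {n : ℕ} (x : Fin n → α) :
    (iidLaw P n).real {x} = ∏ i, P.real {x i} := by
  rw [measureReal_def, iidLaw, Measure.pi_singleton, ENNReal.toReal_prod]
  rfl

/-- Change of measure for product distributions. -/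
lemma iidLaw_real_singleton_eq_exp_mul {Q P : Measure α} [IsProbabilityMeasure Q]
    [IsProbabilityMeasure P] (h : Q ≪ P) {n : ℕ} {x : Fin n → α} (hx : ∀ i, 0 < Q.real {x i}) :
    (iidLaw Q n).real {x} = Real.exp (∑ i, logRatio Q P (x i)) * (iidLaw P n).real {x} := by
  rw [iidLaw_real_singleton, iidLaw_real_singleton, Real.exp_sum, ← Finset.prod_mul_distrib]
  refine Finset.prod_congr rfl fun i _ => ?_
  have hP := measureReal_singleton_pos_of_ac h (hx i)
  rw [logRatio, Real.exp_log (div_pos (hx i) hP), div_mul_cancel₀ _ hP.ne']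

/-- A letter of zero `Q`-mass makes `logRatio` the default value `0`, but the sequence then has zero
`Q^n`-mass, so the inequality survives. -/
lemma iidLaw_real_singleton_le {Q P : Measure α} [IsProbabilityMeasure Q]
    [IsProbabilityMeasure P] (h : Q ≪ P) {n : ℕ} {x : Fin n → α} {c : ℝ}
    (hc : ∑ i, logRatio Q P (x i) ≤ c) :
    (iidLaw Q n).real {x} ≤ Real.exp c * (iidLaw P n).real {x} := by
  by_cases hx : ∀ i, 0 < Q.real {x i}
  · rw [iidLaw_real_singleton_eq_exp_mul h hx]
    gcongr
  · push Not at hx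
    obtain ⟨i, hi⟩ := hx
    rw [iidLaw_real_singleton, Finset.prod_eq_zero (Finset.mem_univ i)
      (le_antisymm hi measureReal_nonneg)]
    positivity

/-- The empirical distribution of a sequence. -/
noncomputable def empirical {n : ℕ} (x : Fin n → α) : Measure α :=
  (n : ℝ≥0∞)⁻¹ • ∑ i, Measure.dirac (x i)

lemma isProbabilityMeasure_empirical {n : ℕ} (hn : 0 < n) (x : Fin n → α) :
    IsProbabilityMeasure (empirical x) := by
  refine ⟨?_⟩
  simp only [empirical, Measure.smul_apply, Measure.finsetSum_apply, measure_univ,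
    Finset.sum_const, Finset.card_univ, Fintype.card_fin, smul_eq_mul, nsmul_eq_mul, mul_one]
  exact ENNReal.inv_mul_cancel (by exact_mod_cast hn.ne') (ENNReal.natCast_ne_top n)

lemma integral_empirical {n : ℕ} (x : Fin n → α) (f : α → ℝ) :
    ∫ a, f a ∂(empirical x) = 1 / (n : ℝ) * ∑ i, f (x i) := by
  rw [empirical, integral_smul_measure, integral_finsetSum_measure fun i _ => .of_finite]
  simp

lemma empirical_map {β : Type*} [Finite β] [MeasurableSpace β] [MeasurableSingletonClass β]
    {n : ℕ} (x : Fin n → α) (f : α → β) :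
    (empirical x).map f = empirical (fun i => f (x i)) := by
  rw [empirical, Measure.map_smul, Measure.map_finset_sum Measurable.of_discrete.aemeasurable]
  simp [empirical, Measure.map_dirac]

lemma empirical_singleton_pos {n : ℕ} (hn : 0 < n) (x : Fin n → α) (i : Fin n) :
    0 < (empirical x).real {x i} := by
  have := isProbabilityMeasure_empirical hn x
  refine measureReal_nonneg.lt_of_ne fun h0 => ?_
  rw [eq_comm, measureReal_eq_zero_iff] at h0
  simp only [empirical, Measure.smul_apply, Measure.finsetSum_apply, smul_eq_mul,
    mul_eq_zero, ENNReal.inv_eq_zero, ENNReal.natCast_ne_top, false_or,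
    Finset.sum_eq_zero_iff, Finset.mem_univ, true_imp_iff] at h0
  simpa using h0 i

lemma empirical_singleton_eq_zero {n : ℕ} {x : Fin n → α} {a : α} (h : ∀ i, x i ≠ a) :
    empirical x {a} = 0 := by
  simp [empirical, h]

/-- The probability of a type class is exponentially small in the relative entropy of the type. -/
lemma iidLaw_real_typeClass_le (P : Measure α) [IsProbabilityMeasure P] {n : ℕ} (hn : 0 < n)
    (x : Fin n → α) {e : ℝ} (he : ENNReal.ofReal e ≤ klDiv (empirical x) P) :
    (iidLaw P n).real {x' | empirical x' = empirical x} ≤ Real.exp (-(e * n)) := by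
  classical
  have := Fintype.ofFinite α
  have hprob := isProbabilityMeasure_empirical hn x
  by_cases hac : empirical x ≪ P
  · have hle := le_integral_logRatio hac he
    rw [integral_empirical, one_div, le_inv_mul_iff₀ (by exact_mod_cast hn)] at hle
    set Q := empirical x with hQ
    have hpt : ∀ x' : Fin n → α, empirical x' = Q →
        (iidLaw P n).real {x'} ≤ Real.exp (-(e * n)) * (iidLaw Q n).real {x'} := by
      intro x' hx'
      have hpos : ∀ i, 0 < Q.real {x' i} := fun i => hx' ▸ empirical_singleton_pos hn x' i
      -- An additive functional of a sequence depends only on its type, so the likelihood ratio is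
      -- constant on the class.
      have hsum : ∑ i, logRatio Q P (x' i) = ∑ i, logRatio Q P (x i) := by
        have h1 := integral_empirical x (logRatio Q P)
        have h2 := integral_empirical x' (logRatio Q P)
        rw [hx'] at h2
        rw [← hQ, h2] at h1
        exact mul_left_cancel₀ (by positivity) h1
      rw [iidLaw_real_singleton_eq_exp_mul hac hpos, ← mul_assoc, ← Real.exp_add, hsum]
      refine le_mul_of_one_le_left measureReal_nonneg (Real.one_le_exp ?_)
      linarith
    have hT : {x' : Fin n → α | empirical x' = Q}
        = ((Finset.univ.filter fun x' => empirical x' = Q : Finset (Fin n → α)) : Set _) := by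
      ext; simp
    rw [hT, ← sum_measureReal_singleton]
    calc _ ≤ ∑ x' ∈ Finset.univ.filter (fun x' => empirical x' = Q),
          Real.exp (-(e * n)) * (iidLaw Q n).real {x'} :=
        Finset.sum_le_sum fun x' hx' => hpt x' (Finset.mem_filter.1 hx').2
      _ = Real.exp (-(e * n)) * (iidLaw Q n).real _ := by
        rw [← Finset.mul_sum, sum_measureReal_singleton]
      _ ≤ Real.exp (-(e * n)) :=
        mul_le_of_le_one_right (Real.exp_pos _).le measureReal_le_one
  · have h0 : (iidLaw P n) {x' | empirical x' = empirical x} = 0 := by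
      -- Every member of the class contains this letter, which `P` almost surely never produces.
      obtain ⟨a, hPa, hQa⟩ : ∃ a, P {a} = 0 ∧ empirical x {a} ≠ 0 := by
        by_contra! hcon
        refine hac fun s hs => ?_
        rw [← Set.biUnion_of_singleton s, measure_biUnion_null_iff s.to_countable]
        exact fun a ha => hcon a (measure_mono_null (Set.singleton_subset_iff.2 ha) hs)
      have hae : ∀ᵐ x' ∂(iidLaw P n), ∀ i, x' i ≠ a := by
        rw [ae_all_iff]
        intro i
        refine (measurePreserving_eval (fun _ : Fin n => P) i).quasiMeasurePreserving.ae
          (p := fun b => b ≠ a) ?_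
        rw [ae_iff]
        simpa using hPa
      refine measure_mono_null (fun x' hx' => ?_) (ae_iff.1 hae)
      intro hx''
      exact hQa (hx' ▸ empirical_singleton_eq_zero hx'')
    rw [measureReal_def, h0]
    simp [(Real.exp_pos _).le]

/-- The number of occurrences of each letter in a sequence. -/
noncomputable def letterCount {n : ℕ} (x : Fin n → α) (a : α) : Fin (n + 1) :=
  open scoped Classical in
  ⟨(Finset.univ.filter fun i => x i = a).card,
    Nat.lt_succ_of_le ((Finset.card_le_univ _).trans_eq (Fintype.card_fin n))⟩

/-- Count vectors take values in a set of size `(n + 1) ^ |α|`, so indexing types by them makes the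
union bound polynomial. -/
lemma empirical_eq_of_letterCount_eq {n : ℕ} {x x' : Fin n → α}
    (h : letterCount x = letterCount x') : empirical x = empirical x' := by
  classical
  have := Fintype.ofFinite α
  have key : ∀ x : Fin n → α, ∑ i, (Measure.dirac (x i) : Measure α)
      = ∑ a, (letterCount x a : ℕ) • Measure.dirac a := by
    intro x
    rw [← Finset.sum_fiberwise Finset.univ x]
    refine Finset.sum_congr rfl fun a _ => ?_
    rw [Finset.sum_congr rfl (g := fun _ => (Measure.dirac a : Measure α))
      (fun i hi => by rw [(Finset.mem_filter.1 hi).2]), Finset.sum_const]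
    simp only [letterCount]
  rw [empirical, empirical, key, key, h]

end Types

/-! ### Converse by joint types -/

section UpperBound

variable {X Y : Type*} [Finite X] [Finite Y] [MeasurableSpace X] [MeasurableSingletonClass X]
  [MeasurableSpace Y] [MeasurableSingletonClass Y]

lemma coe_le_maxMarginalDiv_iff {PX : Measure X} {PY : Measure Y} {Q : Measure (X × Y)} {e : ℝ} :
    (e : EReal) ≤ maxMarginalDiv PX PY Q ↔
      ENNReal.ofReal e ≤ klDiv Q.fst PX ∨ ENNReal.ofReal e ≤ klDiv Q.snd PY := by
  rw [maxMarginalDiv, ← le_max_iff, ← EReal.coe_ennreal_le_coe_ennreal_iff,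
    EReal.coe_ennreal_ofReal, EReal.coe_strictMono.monotone.map_max, max_le_iff]
  simp [EReal.coe_ennreal_nonneg]

/-- Method-of-types bound for the probability of small distance under any coupling. -/
lemma one_sub_minExcessProbIID_le (PX : Measure X) [IsProbabilityMeasure PX] (PY : Measure Y)
    [IsProbabilityMeasure PY] (δ : X → Y → ℝ) (d : ℝ) {e : ℝ}
    (he : ∀ Q ∈ distFeasible δ d, (e : EReal) ≤ maxMarginalDiv PX PY Q) {n : ℕ} (hn : 0 < n) :
    1 - minExcessProbIID δ d PX PY n
      ≤ ((n : ℝ) + 1) ^ Nat.card (X × Y) * Real.exp (-(e * n)) := by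
  classical
  have := Fintype.ofFinite (X × Y)
  refine one_sub_minExcessProb_le fun π hπ => ?_
  have hprob := hπ.1
  set zip : (Fin n → X) × (Fin n → Y) → Fin n → X × Y := fun z i => (z.1 i, z.2 i) with hzip
  set A : Set ((Fin n → X) × (Fin n → Y)) := {z | avgDist δ n z.1 z.2 ≤ d} with hA
  have hcover : A = ⋃ c : X × Y → Fin (n + 1), A ∩ {z | letterCount (zip z) = c} := by
    ext z; simp
  have hbound : ∀ c : X × Y → Fin (n + 1),
      π.real (A ∩ {z | letterCount (zip z) = c}) ≤ Real.exp (-(e * n)) := by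
    intro c
    rcases (A ∩ {z | letterCount (zip z) = c}).eq_empty_or_nonempty with h0 | ⟨z₀, hz₀A, hz₀⟩
    · rw [h0]; simp [(Real.exp_pos _).le]
    have hemp : ∀ z ∈ A ∩ {z | letterCount (zip z) = c},
        empirical (zip z) = empirical (zip z₀) := fun z hz =>
      empirical_eq_of_letterCount_eq (hz.2.trans hz₀.symm)
    have hfeas : empirical (zip z₀) ∈ distFeasible δ d := by
      refine ⟨isProbabilityMeasure_empirical hn _, ?_⟩
      rw [integral_empirical]
      exact hz₀A
    have hfst : ∀ z, (empirical (zip z)).fst = empirical z.1 := fun z => empirical_map _ _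
    have hsnd : ∀ z, (empirical (zip z)).snd = empirical z.2 := fun z => empirical_map _ _
    -- The joint type is feasible, so one of its marginals has divergence at least `e`. Projecting
    -- to that coordinate replaces the arbitrary coupling by a product law.
    rcases coe_le_maxMarginalDiv_iff.1 (he _ hfeas) with h | h
    · rw [hfst] at h
      refine le_trans ?_ (iidLaw_real_typeClass_le PX hn z₀.1 h)
      rw [← hπ.2.1, Measure.fst, map_measureReal_apply .of_discrete .of_discrete]
      refine measureReal_mono fun z hz => ?_
      change empirical z.1 = empirical z₀.1
      rw [← hfst, ← hfst, hemp z hz]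
    · rw [hsnd] at h
      refine le_trans ?_ (iidLaw_real_typeClass_le PY hn z₀.2 h)
      rw [← hπ.2.2, Measure.snd, map_measureReal_apply .of_discrete .of_discrete]
      refine measureReal_mono fun z hz => ?_
      change empirical z.2 = empirical z₀.2
      rw [← hsnd, ← hsnd, hemp z hz]
  change π.real A ≤ _
  rw [hcover]
  refine (measureReal_iUnion_fintype_le _).trans ((Finset.sum_le_sum fun c _ => hbound c).trans ?_)
  simp [Fintype.card_pi, Finset.prod_const, Nat.card_eq_fintype_card]

end UpperBound

/-! ### Attainment of minima over distributions on a finite alphabet -/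

section Compactness

variable {α : Type*} [Fintype α] [MeasurableSpace α] [MeasurableSingletonClass α]

/-- The probability mass function of a measure, as a real vector. -/
noncomputable def massVector (Q : Measure α) (a : α) : ℝ := Q.real {a}

lemma massVector_mem_stdSimplex (Q : Measure α) [IsProbabilityMeasure Q] :
    massVector Q ∈ stdSimplex ℝ α := by
  refine ⟨fun a => measureReal_nonneg, ?_⟩
  simp only [massVector]
  rw [sum_measureReal_singleton, Finset.coe_univ, probReal_univ]

lemma exists_massVector_eq {v : α → ℝ} (hv : v ∈ stdSimplex ℝ α) :
    ∃ Q : Measure α, IsProbabilityMeasure Q ∧ massVector Q = v := by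
  classical
  have key : ∀ a, (∑ b, ENNReal.ofReal (v b) • Measure.dirac b : Measure α) {a}
      = ENNReal.ofReal (v a) := by
    intro a
    simp [Measure.finsetSum_apply, Set.indicator_apply]
  refine ⟨∑ b, ENNReal.ofReal (v b) • Measure.dirac b, ⟨?_⟩, ?_⟩
  · simp only [Measure.finsetSum_apply, Measure.smul_apply, measure_univ, smul_eq_mul, mul_one]
    rw [← ENNReal.ofReal_sum_of_nonneg fun a _ => hv.1 a, hv.2, ENNReal.ofReal_one]
  · ext a
    rw [massVector, measureReal_def, key, ENNReal.toReal_ofReal (hv.1 a)]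

/-- Probability measures correspond to points of the compact simplex, where a continuous function
attains its minimum on a closed part. -/
lemma exists_min_massVector {S : Set (α → ℝ)} (hS : IsClosed S) {F : (α → ℝ) → ℝ}
    (hF : Continuous F)
    (hne : ∃ Q : Measure α, IsProbabilityMeasure Q ∧ massVector Q ∈ S) :
    ∃ Q : Measure α, IsProbabilityMeasure Q ∧ massVector Q ∈ S ∧
      ∀ Q' : Measure α, IsProbabilityMeasure Q' → massVector Q' ∈ S →
        F (massVector Q) ≤ F (massVector Q') := by
  obtain ⟨Q₀, hQ₀, hQ₀S⟩ := hne
  obtain ⟨v, ⟨hv, hvS⟩, hmin⟩ := ((isCompact_stdSimplex ℝ α).inter_right hS).exists_isMinOn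
    ⟨massVector Q₀, massVector_mem_stdSimplex Q₀, hQ₀S⟩ hF.continuousOn
  obtain ⟨Q, hQ, rfl⟩ := exists_massVector_eq hv
  exact ⟨Q, hQ, hvS, fun Q' hQ' hQ'S => hmin ⟨massVector_mem_stdSimplex Q', hQ'S⟩⟩

lemma eq_of_massVector_eq {μ ν : Measure α} [IsFiniteMeasure μ] [IsFiniteMeasure ν]
    (h : massVector μ = massVector ν) : μ = ν :=
  Measure.ext_of_singleton fun a => (measureReal_eq_measureReal_iff).1 (congrFun h a)

lemma integral_eq_sum_massVector (Q : Measure α) [IsFiniteMeasure Q] (f : α → ℝ) :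
    ∫ a, f a ∂Q = ∑ a, massVector Q a * f a := by
  simp [integral_fintype .of_finite, massVector]

variable {β : Type*} [Fintype β] [DecidableEq β] [MeasurableSpace β] [MeasurableSingletonClass β]

/-- The push-forward of a mass vector. -/
def pushVector (f : α → β) (v : α → ℝ) (b : β) : ℝ :=
  ∑ a with f a = b, v a

lemma massVector_map (Q : Measure α) [IsFiniteMeasure Q] (f : α → β) :
    massVector (Q.map f) = pushVector f (massVector Q) := by
  ext b
  simp only [massVector, pushVector]
  rw [map_measureReal_apply .of_discrete .of_discrete, sum_measureReal_singleton]
  congr 1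
  ext a
  simp

lemma continuous_pushVector (f : α → β) (b : β) : Continuous fun v => pushVector f v b := by
  unfold pushVector
  fun_prop

/-- Absolute continuity of a marginal becomes a closed condition on the mass vector. -/
lemma map_absolutelyContinuous_iff {Q : Measure α} [IsFiniteMeasure Q] {P : Measure β}
    [IsFiniteMeasure P] {f : α → β} :
    Q.map f ≪ P ↔ ∀ a, P.real {f a} = 0 → massVector Q a = 0 := by
  have hQ : ∀ a, massVector Q a = 0 ↔ Q {a} = 0 := fun a => measureReal_eq_zero_iff
  have hP : ∀ b, P.real {b} = 0 ↔ P {b} = 0 := fun b => measureReal_eq_zero_iff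
  simp only [hQ, hP]
  constructor
  · intro h a ha
    have := h ha
    rw [Measure.map_apply .of_discrete .of_discrete] at this
    exact measure_mono_null (by simp) this
  · intro h s hs
    rw [Measure.map_apply .of_discrete .of_discrete, ← Set.biUnion_of_singleton (f ⁻¹' s),
      measure_biUnion_null_iff (f ⁻¹' s).to_countable]
    exact fun a ha => h a (measure_mono_null (Set.singleton_subset_iff.2 ha) hs)

/-- The relative entropy as a function of the mass vector. -/
noncomputable def klVector (P : Measure β) (w : β → ℝ) : ℝ :=
  ∑ b, (w b * Real.log (w b) - w b * Real.log (P.real {b}))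

/-- `klVector` is continuous everywhere because `Real.log 0 = 0`, but represents the divergence only
under absolute continuity. Off that set the divergence is infinite. -/
lemma klDiv_map_eq_ofReal {Q : Measure α} [IsProbabilityMeasure Q] {P : Measure β}
    [IsProbabilityMeasure P] {f : α → β} (h : Q.map f ≪ P) :
    klDiv (Q.map f) P = ENNReal.ofReal (klVector P (pushVector f (massVector Q))) := by
  have : IsProbabilityMeasure (Q.map f) :=
    Measure.isProbabilityMeasure_map Measurable.of_discrete.aemeasurable
  rw [klDiv_eq_ofReal_integral_logRatio h, integral_eq_sum_massVector, ← massVector_map, klVector]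
  congr 1
  refine Finset.sum_congr rfl fun b _ => ?_
  by_cases hb : massVector (Q.map f) b = 0
  · simp [hb]
  · have hb' : 0 < (Q.map f).real {b} := measureReal_nonneg.lt_of_ne (Ne.symm hb)
    change _ * Real.log (massVector (Q.map f) b / _) = _
    rw [Real.log_div hb (measureReal_singleton_pos_of_ac h hb').ne', mul_sub]

lemma continuous_klVector_pushVector (P : Measure β) (f : α → β) :
    Continuous fun v => klVector P (pushVector f v) := by
  unfold klVector
  refine continuous_finsetSum _ fun b _ => ?_
  exact (Real.continuous_mul_log.comp (continuous_pushVector f b)).sub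
    ((continuous_pushVector f b).mul continuous_const)

end Compactness

/-! ### Optimal couplings and minimal marginal divergence -/

section Attainment

variable {X Y : Type*} [Finite X] [Finite Y] [MeasurableSpace X] [MeasurableSingletonClass X]
  [MeasurableSpace Y] [MeasurableSingletonClass Y]
  (PX : Measure X) [IsProbabilityMeasure PX] (PY : Measure Y) [IsProbabilityMeasure PY]
  (δ : X → Y → ℝ)

lemma minDist_le {π : Measure (X × Y)} (hπ : π ∈ couplings PX PY) :
    minDist δ PX PY ≤ ∫ z, δ z.1 z.2 ∂π := by
  refine csInf_le ?_ ⟨π, hπ, rfl⟩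
  obtain ⟨B, hB⟩ := (Set.finite_range fun z : X × Y => δ z.1 z.2).bddBelow
  refine ⟨B, ?_⟩
  rintro _ ⟨ρ, hρ, rfl⟩
  have := hρ.1
  have := integral_mono (μ := ρ) .of_finite .of_finite (fun z => hB ⟨z, rfl⟩ : (fun _ => B) ≤ _)
  simpa using this

/-- The minimum defining `minDist` is attained. -/
lemma exists_optimal_coupling :
    ∃ π ∈ couplings PX PY, ∫ z, δ z.1 z.2 ∂π = minDist δ PX PY := by
  classical
  have := Fintype.ofFinite X
  have := Fintype.ofFinite Y
  set S : Set (X × Y → ℝ) := {v | (∀ x, pushVector Prod.fst v x = massVector PX x) ∧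
    ∀ y, pushVector Prod.snd v y = massVector PY y} with hSdef
  have hS : IsClosed S := by
    simp only [hSdef, Set.ofPred_and, Set.ofPred_forall]
    exact (isClosed_iInter fun x => isClosed_eq (continuous_pushVector _ x) continuous_const).inter
      (isClosed_iInter fun y => isClosed_eq (continuous_pushVector _ y) continuous_const)
  have hiff : ∀ Q : Measure (X × Y), IsProbabilityMeasure Q →
      (massVector Q ∈ S ↔ Q ∈ couplings PX PY) := by
    intro Q hQ
    change _ ↔ IsProbabilityMeasure Q ∧ Q.map Prod.fst = PX ∧ Q.map Prod.snd = PY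
    have h1 : Q.map Prod.fst = PX ↔ ∀ x, pushVector Prod.fst (massVector Q) x = massVector PX x := by
      rw [← funext_iff, ← massVector_map]
      exact ⟨fun h => h ▸ rfl, eq_of_massVector_eq⟩
    have h2 : Q.map Prod.snd = PY ↔ ∀ y, pushVector Prod.snd (massVector Q) y = massVector PY y := by
      rw [← funext_iff, ← massVector_map]
      exact ⟨fun h => h ▸ rfl, eq_of_massVector_eq⟩
    rw [h1, h2]
    exact ⟨fun h => ⟨hQ, h⟩, fun h => h.2⟩
  obtain ⟨Q₀, hQ₀⟩ := couplings_nonempty PX PY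
  obtain ⟨Q, hQ, hQS, hmin⟩ := exists_min_massVector hS
    (F := fun v => ∑ z : X × Y, v z * δ z.1 z.2) (by fun_prop) ⟨Q₀, hQ₀.1, (hiff Q₀ hQ₀.1).2 hQ₀⟩
  have hQc := (hiff Q hQ).1 hQS
  refine ⟨Q, hQc, le_antisymm (le_csInf ⟨_, Q, hQc, rfl⟩ ?_) (minDist_le PX PY δ hQc)⟩
  rintro _ ⟨Q', hQ', rfl⟩
  have hp := hQ'.1
  have h := hmin Q' hQ'.1 ((hiff Q' hQ'.1).2 hQ')
  simp only
  rwa [integral_eq_sum_massVector, integral_eq_sum_massVector]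

/-- The larger marginal divergence attains its minimum over the feasible joint distributions. -/
lemma exists_min_maxMarginalDiv {d : ℝ} (hne : (distFeasible δ d).Nonempty) :
    ∃ Q ∈ distFeasible δ d, ∀ Q' ∈ distFeasible δ d,
      maxMarginalDiv PX PY Q ≤ maxMarginalDiv PX PY Q' := by
  classical
  have := Fintype.ofFinite X
  have := Fintype.ofFinite Y
  set S : Set (X × Y → ℝ) := {v | ∑ z : X × Y, v z * δ z.1 z.2 ≤ d ∧
    (∀ z : X × Y, PX.real {z.1} = 0 → v z = 0) ∧ ∀ z : X × Y, PY.real {z.2} = 0 → v z = 0}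
    with hSdef
  have hS : IsClosed S := by
    simp only [hSdef, Set.ofPred_and, Set.ofPred_forall]
    refine (isClosed_le (by fun_prop) continuous_const).inter (IsClosed.inter ?_ ?_) <;>
    exact isClosed_iInter fun z => isClosed_iInter fun _ =>
      isClosed_eq (continuous_apply z) continuous_const
  have hiff : ∀ Q : Measure (X × Y), IsProbabilityMeasure Q →
      (massVector Q ∈ S ↔ Q ∈ distFeasible δ d ∧ Q.fst ≪ PX ∧ Q.snd ≪ PY) := by
    intro Q hQ
    change _ ↔ (IsProbabilityMeasure Q ∧ ∫ z, δ z.1 z.2 ∂Q ≤ d) ∧ _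
    rw [Measure.fst, Measure.snd, map_absolutelyContinuous_iff, map_absolutelyContinuous_iff,
      integral_eq_sum_massVector]
    exact ⟨fun h => ⟨⟨hQ, h.1⟩, h.2⟩, fun h => ⟨h.1.2, h.2⟩⟩
  -- If some feasible distribution has absolutely continuous marginals, only such competitors
  -- matter; otherwise all values are infinite and any feasible one is minimal.
  by_cases hfin : ∃ Q : Measure (X × Y), IsProbabilityMeasure Q ∧ massVector Q ∈ S
  · obtain ⟨Q, hQ, hQS, hmin⟩ := exists_min_massVector hS
      ((continuous_klVector_pushVector PX Prod.fst).max
        (continuous_klVector_pushVector PY Prod.snd)) hfin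
    have hQ' := (hiff Q hQ).1 hQS
    refine ⟨Q, hQ'.1, fun R hR => ?_⟩
    have hRp := hR.1
    rw [maxMarginalDiv, maxMarginalDiv, EReal.coe_ennreal_le_coe_ennreal_iff]
    by_cases hac : R.fst ≪ PX ∧ R.snd ≪ PY
    · have h := ENNReal.ofReal_mono (hmin R hR.1 ((hiff R hR.1).2 ⟨hR, hac⟩))
      rw [ENNReal.ofReal_mono.map_max, ENNReal.ofReal_mono.map_max] at h
      rwa [Measure.fst, Measure.snd, klDiv_map_eq_ofReal hQ'.2.1, klDiv_map_eq_ofReal hQ'.2.2,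
        Measure.fst, Measure.snd, klDiv_map_eq_ofReal hac.1, klDiv_map_eq_ofReal hac.2]
    · rcases not_and_or.1 hac with h | h <;> simp [klDiv_of_not_ac h]
  · obtain ⟨Q, hQ⟩ := hne
    refine ⟨Q, hQ, fun R hR => ?_⟩
    have hac : ¬ (R.fst ≪ PX ∧ R.snd ≪ PY) := fun hac =>
      hfin ⟨R, hR.1, (hiff R hR.1).2 ⟨hR, hac⟩⟩
    rw [maxMarginalDiv, maxMarginalDiv, EReal.coe_ennreal_le_coe_ennreal_iff]
    rcases not_and_or.1 hac with h | h <;> simp [klDiv_of_not_ac h]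

end Attainment

/-! ### Achievability of the exponent -/

section Achievability

open ProbabilityTheory

/-- The weak law of large numbers, one-sided, for i.i.d. variables on a finite alphabet. -/
lemma tendsto_iidLaw_real_lt_sum {α : Type*} [Finite α] [MeasurableSpace α]
    [MeasurableSingletonClass α] (Q : Measure α) [IsProbabilityMeasure Q] (f : α → ℝ) {e : ℝ}
    (he : ∫ a, f a ∂Q < e) :
    Tendsto (fun n : ℕ => (iidLaw Q n).real {z | e * n < ∑ i, f (z i)}) atTop (𝓝 0) := by
  set m := ∫ a, f a ∂Q with hm
  have hlim : Tendsto (fun n : ℕ => Var[f; Q] / (e - m) ^ 2 / (n : ℝ)) atTop (𝓝 0) :=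
    tendsto_const_div_atTop_nhds_zero_nat _
  refine squeeze_zero' (Eventually.of_forall fun n => measureReal_nonneg) ?_ hlim
  filter_upwards [eventually_gt_atTop 0] with n hn
  have hn' : (0 : ℝ) < n := by exact_mod_cast hn
  have hem : 0 < e - m := sub_pos.2 he
  have h := meas_ge_le_variance_div_sq (μ := iidLaw Q n)
    (X := fun z => ∑ i, f (z i)) .of_discrete (mul_pos hem hn')
  rw [integral_sum_iidLaw, variance_sum_iidLaw, ← hm] at h
  have h2 := ENNReal.toReal_mono ENNReal.ofReal_ne_top h
  rw [ENNReal.toReal_ofReal (by have := variance_nonneg f Q; positivity)] at h2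
  refine (measureReal_mono fun z hz => ?_).trans (h2.trans (le_of_eq ?_))
  · change e * n < ∑ i, f (z i) at hz
    change (e - m) * n ≤ |∑ i, f (z i) - n * m|
    exact le_trans (by linarith) (le_abs_self _)
  · field_simp

lemma measure_le_of_singleton {α : Type*} [Finite α] [MeasurableSpace α]
    [MeasurableSingletonClass α] {μ ν : Measure α} (h : ∀ a, μ {a} ≤ ν {a}) : μ ≤ ν := by
  classical
  refine Measure.le_iff.2 fun s _ => ?_
  have hs := s.toFinite
  rw [← hs.coe_toFinset, ← sum_measure_singleton, ← sum_measure_singleton]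
  exact Finset.sum_le_sum fun a _ => h a

variable {X Y : Type*} [Finite X] [Finite Y] [MeasurableSpace X] [MeasurableSingletonClass X]
  [MeasurableSpace Y] [MeasurableSingletonClass Y]

/-- A scaled i.i.d. law, restricted to sequences of small likelihood ratio, is dominated by the
product of the reference distribution. -/
lemma smul_restrict_map_le {Z γ : Type*} [Finite Z] [MeasurableSpace Z]
    [MeasurableSingletonClass Z] [Finite γ] [MeasurableSpace γ] [MeasurableSingletonClass γ]
    {P Q : Measure γ} [IsProbabilityMeasure P] [IsProbabilityMeasure Q] (hac : Q ≪ P) {n : ℕ}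
    {J : Measure Z} {p : Z → Fin n → γ} (hJ : J.map p = iidLaw Q n) {c : ℝ} {G : Set Z}
    (hG : ∀ z ∈ G, ∑ i, logRatio Q P (p z i) ≤ c) :
    (ENNReal.ofReal (Real.exp (-c)) • J.restrict G).map p ≤ iidLaw P n := by
  refine measure_le_of_singleton fun x => ?_
  rw [Measure.map_apply .of_discrete .of_discrete, Measure.smul_apply, smul_eq_mul,
    Measure.restrict_apply .of_discrete]
  by_cases hx : ∑ i, logRatio Q P (x i) ≤ c
  · have h1 : J (p ⁻¹' {x} ∩ G) ≤ iidLaw Q n {x} := by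
      rw [← hJ, Measure.map_apply .of_discrete .of_discrete]
      exact measure_mono Set.inter_subset_left
    refine (mul_le_mul_right h1 _).trans ?_
    have h2 := iidLaw_real_singleton_le hac hx
    rw [← ofReal_measureReal, ← ofReal_measureReal, ← ENNReal.ofReal_mul (Real.exp_pos _).le]
    refine ENNReal.ofReal_le_ofReal ?_
    refine (mul_le_mul_of_nonneg_left h2 (Real.exp_pos _).le).trans (le_of_eq ?_)
    rw [← mul_assoc, ← Real.exp_add]
    simp
  · have : p ⁻¹' {x} ∩ G = ∅ := by
      refine Set.eq_empty_of_forall_notMem fun z hz => hx ?_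
      obtain ⟨rfl, hz⟩ := hz
      exact hG z hz
    simp [this]

/-- The probability of small distance is at least of exponential order of the larger marginal
divergence of any feasible joint distribution. -/
lemma eventually_le_one_sub_minExcessProbIID (PX : Measure X) [IsProbabilityMeasure PX]
    (PY : Measure Y) [IsProbabilityMeasure PY] (δ : X → Y → ℝ) (d : ℝ) {Q : Measure (X × Y)}
    (hQ : Q ∈ distFeasible δ d) {e : ℝ} (he : maxMarginalDiv PX PY Q < e) :
    ∀ᶠ n : ℕ in atTop, 1 / 4 * Real.exp (-(e * n)) ≤ 1 - minExcessProbIID δ d PX PY n := by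
  have hp := hQ.1
  have hlt : ¬ (ENNReal.ofReal e ≤ klDiv Q.fst PX ∨ ENNReal.ofReal e ≤ klDiv Q.snd PY) := by
    rw [← coe_le_maxMarginalDiv_iff, not_le]; exact he
  push Not at hlt
  have hac1 : Q.fst ≪ PX := (klDiv_ne_top_iff.1 (hlt.1.trans_le le_top).ne).1
  have hac2 : Q.snd ≪ PY := (klDiv_ne_top_iff.1 (hlt.2.trans_le le_top).ne).1
  have h1 : ∫ z, logRatio Q.fst PX z.1 ∂Q < e := by
    have h := hlt.1
    rw [klDiv_eq_ofReal_integral_logRatio hac1] at h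
    have h' := (ENNReal.ofReal_lt_ofReal_iff_of_nonneg (integral_logRatio_nonneg hac1)).1 h
    rwa [Measure.fst, integral_map .of_discrete Measurable.of_discrete.aestronglyMeasurable] at h'
  have h2 : ∫ z, logRatio Q.snd PY z.2 ∂Q < e := by
    have h := hlt.2
    rw [klDiv_eq_ofReal_integral_logRatio hac2] at h
    have h' := (ENNReal.ofReal_lt_ofReal_iff_of_nonneg (integral_logRatio_nonneg hac2)).1 h
    rwa [Measure.snd, integral_map .of_discrete Measurable.of_discrete.aestronglyMeasurable] at h'
  obtain ⟨C, hC⟩ := exists_half_sub_le_iidLaw Q (fun z => δ z.1 z.2) hQ.2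
  have hlim : Tendsto (fun n : ℕ => 1 / 2 - C / √(n : ℝ)
      - (iidLaw Q n).real {z | e * n < ∑ i, logRatio Q.fst PX (z i).1}
      - (iidLaw Q n).real {z | e * n < ∑ i, logRatio Q.snd PY (z i).2}) atTop (𝓝 (1 / 2)) := by
    have hs : Tendsto (fun n : ℕ => C / √(n : ℝ)) atTop (𝓝 0) :=
      (Real.tendsto_sqrt_atTop.comp tendsto_natCast_atTop_atTop).const_div_atTop C
    have := ((hs.const_sub (1 / 2)).sub
      (tendsto_iidLaw_real_lt_sum Q (fun z => logRatio Q.fst PX z.1) h1)).sub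
      (tendsto_iidLaw_real_lt_sum Q (fun z => logRatio Q.snd PY z.2) h2)
    simpa using this
  -- Any constant below the limit `1 / 2` would do.
  filter_upwards [hlim.eventually (lt_mem_nhds (by norm_num : (1 / 4 : ℝ) < 1 / 2)),
    eventually_gt_atTop 0] with n hn hn0
  set A : Set ((Fin n → X) × (Fin n → Y)) := {z | avgDist δ n z.1 z.2 ≤ d} with hA
  set B₁ : Set ((Fin n → X) × (Fin n → Y)) := {z | e * n < ∑ i, logRatio Q.fst PX (z.1 i)}
  set B₂ : Set ((Fin n → X) × (Fin n → Y)) := {z | e * n < ∑ i, logRatio Q.snd PY (z.2 i)}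
  set G := (A \ B₁) \ B₂ with hG
  have hGmass : 1 / 4 ≤ (iidJoint Q n).real G := by
    have hAm : 1 / 2 - C / √(n : ℝ) ≤ (iidJoint Q n).real A := by
      rw [iidJoint_real_apply]
      exact hC n hn0
    have hB₁ : (iidJoint Q n).real B₁
        = (iidLaw Q n).real {z | e * n < ∑ i, logRatio Q.fst PX (z i).1} :=
      iidJoint_real_apply _ _ _
    have hB₂ : (iidJoint Q n).real B₂
        = (iidLaw Q n).real {z | e * n < ∑ i, logRatio Q.snd PY (z i).2} :=
      iidJoint_real_apply _ _ _
    have e1 := le_measureReal_sdiff (μ := iidJoint Q n) (s₁ := A) (s₂ := B₁)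
    have e2 := le_measureReal_sdiff (μ := iidJoint Q n) (s₁ := A \ B₁) (s₂ := B₂)
    linarith
  -- On `G` both likelihood ratios are at most `exp (e * n)`, so this scaling puts both marginals
  -- below the product laws.
  set σ := ENNReal.ofReal (Real.exp (-(e * n))) • (iidJoint Q n).restrict G with hσ
  obtain ⟨π, hπ, hle⟩ := exists_coupling_ge (μ := iidLaw PX n) (ν := iidLaw PY n) σ
    (smul_restrict_map_le hac1 (iidJoint_fst Q n) fun z hz => not_lt.1 hz.1.2)
    (smul_restrict_map_le hac2 (iidJoint_snd Q n) fun z hz => not_lt.1 hz.2)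
  have hπp := hπ.1
  refine le_trans ?_ (measureReal_le_one_sub_minExcessProb hπ)
  have hσA : σ.real A = Real.exp (-(e * n)) * (iidJoint Q n).real G := by
    rw [hσ, measureReal_ennreal_smul_apply, ENNReal.toReal_ofReal (Real.exp_pos _).le,
      measureReal_restrict_apply .of_discrete,
      Set.inter_eq_right.2 fun z hz => hz.1.1]
  have hmono : σ.real A ≤ π.real A :=
    ENNReal.toReal_mono (measure_ne_top _ _) (hle A)
  rw [hσA] at hmono
  refine le_trans ?_ hmono
  rw [mul_comm]
  exact mul_le_mul_of_nonneg_left hGmass (Real.exp_pos _).le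

end Achievability

/-! ### Decay exponents -/

section DecayExponent

lemma neg_log_div_of_pos {x : ℝ} (hx : 0 < x) (n : ℕ) :
    (-ENNReal.log (ENNReal.ofReal x)) / (n : EReal) = ((-Real.log x / n : ℝ) : EReal) := by
  rw [ENNReal.log_ofReal_of_pos hx, EReal.coe_div, EReal.coe_neg]
  rfl

lemma neg_log_div_of_nonpos {x : ℝ} (hx : x ≤ 0) {n : ℕ} (hn : 0 < n) :
    (-ENNReal.log (ENNReal.ofReal x)) / (n : EReal) = ⊤ := by
  rw [ENNReal.ofReal_of_nonpos hx, ENNReal.log_zero, EReal.neg_bot]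
  exact EReal.top_div_of_pos_ne_top (by exact_mod_cast hn) (EReal.natCast_ne_top n)

/-- The polynomial factor costs `k * log (n + 1) / n`, which vanishes in the limit. -/
lemma coe_le_decayExponent {a : ℕ → ℝ} {e : ℝ} {k : ℕ}
    (h : ∀ᶠ n : ℕ in atTop, a n ≤ ((n : ℝ) + 1) ^ k * Real.exp (-(e * n))) :
    (e : EReal) ≤ decayExponent a := by
  have hlim : Tendsto (fun n : ℕ => e - k * (Real.log ((n : ℝ) + 1) / n)) atTop (𝓝 e) := by
    have h1 : Tendsto (fun n : ℕ => Real.log ((n : ℝ) + 1) / n) atTop (𝓝 0) := by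
      -- Evaluated at `n + 1`, the denominator `1 * x + (-1)` is `n`.
      have := (Real.tendsto_pow_log_div_mul_add_atTop 1 (-1) 1 one_ne_zero).comp
        ((tendsto_natCast_atTop_atTop (R := ℝ)).atTop_add tendsto_const_nhds (C := 1))
      simpa [Function.comp_def] using this
    simpa using (h1.const_mul (k : ℝ)).const_sub e
  have hlim' := (continuous_coe_real_ereal.tendsto e).comp hlim
  rw [← hlim'.liminf_eq, decayExponent]
  refine liminf_le_liminf ?_
  filter_upwards [h, eventually_gt_atTop 0] with n hn hn0
  have hn' : (0 : ℝ) < n := by exact_mod_cast hn0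
  rcases le_or_gt (a n) 0 with ha | ha
  · rw [neg_log_div_of_nonpos ha hn0]; exact le_top
  · rw [neg_log_div_of_pos ha]
    simp only [Function.comp_apply, EReal.coe_le_coe_iff]
    have hl := Real.log_le_log ha hn
    rw [Real.log_mul (by positivity) (Real.exp_pos _).ne', Real.log_pow, Real.log_exp] at hl
    rw [le_div_iff₀ hn']
    have : (e - k * (Real.log ((n : ℝ) + 1) / n)) * n = e * n - k * Real.log ((n : ℝ) + 1) := by
      field_simp
    linarith

lemma decayExponent_le_coe {a : ℕ → ℝ} {e c : ℝ} (hc : 0 < c)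
    (h : ∀ᶠ n : ℕ in atTop, c * Real.exp (-(e * n)) ≤ a n) :
    decayExponent a ≤ (e : EReal) := by
  have hlim : Tendsto (fun n : ℕ => e - Real.log c / n) atTop (𝓝 e) := by
    simpa using (tendsto_const_div_atTop_nhds_zero_nat (Real.log c)).const_sub e
  have hlim' := (continuous_coe_real_ereal.tendsto e).comp hlim
  rw [← hlim'.liminf_eq, decayExponent]
  refine liminf_le_liminf ?_
  filter_upwards [h, eventually_gt_atTop 0] with n hn hn0
  have hn' : (0 : ℝ) < n := by exact_mod_cast hn0
  have hpos : 0 < c * Real.exp (-(e * n)) := by positivity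
  rw [neg_log_div_of_pos (hpos.trans_le hn)]
  simp only [Function.comp_apply, EReal.coe_le_coe_iff]
  have hl := Real.log_le_log hpos hn
  rw [Real.log_mul hc.ne' (Real.exp_pos _).ne', Real.log_exp] at hl
  rw [div_le_iff₀ hn']
  have : (e - Real.log c / n) * n = e * n - Real.log c := by field_simp
  linarith

end DecayExponent

/-! ### Exponential decay -/

section Decay

/-- Half of the exponent absorbs the polynomial, through `y ^ k / k! ≤ exp y` at `y = e / 2 * (n +
1)`. -/
lemma add_one_pow_mul_exp_neg_le {e : ℝ} (he : 0 < e) (k n : ℕ) :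
    ((n : ℝ) + 1) ^ k * Real.exp (-(e * n))
      ≤ k.factorial * Real.exp (e / 2) / (e / 2) ^ k * Real.exp (-(e / 2 * n)) := by
  have h := Real.pow_div_factorial_le_exp (e / 2 * ((n : ℝ) + 1)) (by positivity) k
  rw [div_le_iff₀ (by positivity), mul_pow] at h
  have h1 : ((n : ℝ) + 1) ^ k
      ≤ k.factorial * Real.exp (e / 2 * ((n : ℝ) + 1)) / (e / 2) ^ k := by
    rw [le_div_iff₀ (by positivity)]
    linarith
  refine (mul_le_mul_of_nonneg_right h1 (Real.exp_pos _).le).trans (le_of_eq ?_)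
  have h2 : Real.exp (e / 2 * ((n : ℝ) + 1)) * Real.exp (-(e * n))
      = Real.exp (e / 2) * Real.exp (-(e / 2 * n)) := by
    rw [← Real.exp_add, ← Real.exp_add]
    congr 1
    ring
  rw [div_mul_eq_mul_div, mul_assoc, h2]
  ring

lemma tendsto_zero_of_le_exp {a : ℕ → ℝ} (ha : ∀ n, 0 ≤ a n) {C κ : ℝ} (hκ : 0 < κ)
    (h : ∀ n : ℕ, a n ≤ C * Real.exp (-(κ * n))) : Tendsto a atTop (𝓝 0) := by
  refine squeeze_zero ha h ?_
  have h1 : Tendsto (fun n : ℕ => κ * (n : ℝ)) atTop atTop :=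
    tendsto_natCast_atTop_atTop.const_mul_atTop hκ
  simpa using (Real.tendsto_exp_neg_atTop_nhds_zero.comp h1).const_mul C

open ProbabilityTheory in
-- The function `t * d - cgf f Q t` vanishes at `0` with positive derivative `d - ∫ f`.
lemma exists_pos_mul_sub_log_integral_exp {α : Type*} [Finite α] [MeasurableSpace α]
    [MeasurableSingletonClass α] (Q : Measure α) [IsProbabilityMeasure Q] (f : α → ℝ) {d : ℝ}
    (hd : ∫ a, f a ∂Q < d) :
    ∃ t : ℝ, 0 < t ∧ 0 < t * d - Real.log (∫ a, Real.exp (t * f a) ∂Q) := by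
  have hset : (0 : ℝ) ∈ interior (integrableExpSet f Q) := by
    have : integrableExpSet f Q = Set.univ := Set.eq_univ_of_forall fun t => .of_finite
    simp [this]
  have h1 : HasDerivAt (cgf f Q) (∫ a, f a ∂Q) 0 := by
    have := (analyticAt_cgf hset).differentiableAt.hasDerivAt
    rwa [deriv_cgf_zero hset, probReal_univ, div_one] at this
  have h2 : HasDerivAt (fun t => t * d - cgf f Q t) (d - ∫ a, f a ∂Q) 0 := by
    exact (((hasDerivAt_id (0 : ℝ)).mul_const d).sub h1).congr_deriv (by simp)
  have h3 := h2.tendsto_slope_zero_right.eventually (lt_mem_nhds (sub_pos.2 hd))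
  obtain ⟨t, ht, ht0⟩ := (h3.and self_mem_nhdsWithin).exists
  have ht0' : 0 < t := ht0
  refine ⟨t, ht0', ?_⟩
  simp only [zero_add, zero_mul, cgf_zero, sub_zero, smul_eq_mul] at ht
  exact (pos_iff_pos_of_mul_pos ht).1 (inv_pos.2 ht0')

end Decay

/-! ### Assembly of the three regimes -/

section Main

variable {X Y : Type*} [Finite X] [Finite Y] [MeasurableSpace X] [MeasurableSingletonClass X]
  [MeasurableSpace Y] [MeasurableSingletonClass Y]
  (PX : Measure X) [IsProbabilityMeasure PX] (PY : Measure Y) [IsProbabilityMeasure PY]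
  (δ : X → Y → ℝ) (d : ℝ)

lemma minExcessProbIID_nonneg (n : ℕ) : 0 ≤ minExcessProbIID δ d PX PY n :=
  minExcessProb_nonneg

lemma minExcessProbIID_le_one (n : ℕ) : minExcessProbIID δ d PX PY n ≤ 1 :=
  minExcessProb_le_one

/-- Needs no relation between `d` and the transport cost. Each real above the value at a feasible
`Q` is achievable, and each real below the infimum is a converse bound; with no feasible `Q` both
sides are `⊤`. -/
lemma decayExponent_one_sub_minExcessProbIID :
    decayExponent (fun n => 1 - minExcessProbIID δ d PX PY n)
      = ⨅ Q ∈ distFeasible δ d, maxMarginalDiv PX PY Q := by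
  refine le_antisymm (le_iInf₂ fun Q hQ => ?_) ?_
  · refine EReal.le_of_forall_lt_iff_le.1 fun e he => ?_
    exact decayExponent_le_coe (by norm_num)
      (eventually_le_one_sub_minExcessProbIID PX PY δ d hQ he)
  · refine EReal.ge_of_forall_gt_iff_ge.1 fun e he => ?_
    refine coe_le_decayExponent (k := Nat.card (X × Y)) ?_
    filter_upwards [eventually_gt_atTop 0] with n hn
    exact one_sub_minExcessProbIID_le PX PY δ d
      (fun Q hQ => he.le.trans (iInf₂_le Q hQ)) hn

variable {d}

/-- Below the transport cost, the divergences of feasible joint distributions are bounded away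
from zero. -/
lemma exists_pos_le_maxMarginalDiv (hd : d < minDist δ PX PY) :
    ∃ e : ℝ, 0 < e ∧ ∀ Q ∈ distFeasible δ d, (e : EReal) ≤ maxMarginalDiv PX PY Q := by
  by_cases hne : (distFeasible δ d).Nonempty
  · obtain ⟨Q, hQ, hmin⟩ := exists_min_maxMarginalDiv PX PY δ hne
    have hp := hQ.1
    have hpos : (0 : EReal) < maxMarginalDiv PX PY Q := by
      rw [maxMarginalDiv, EReal.coe_ennreal_pos, pos_iff_ne_zero]
      intro h0
      have h1 : klDiv Q.fst PX = 0 := le_antisymm ((le_max_left _ _).trans h0.le) zero_le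
      have h2 : klDiv Q.snd PY = 0 := le_antisymm ((le_max_right _ _).trans h0.le) zero_le
      rw [klDiv_eq_zero_iff] at h1 h2
      -- Zero divergences make the minimiser a coupling of cost at most `d`.
      exact absurd ((minDist_le PX PY δ ⟨hp, h1, h2⟩).trans hQ.2) (not_le.2 hd)
    obtain ⟨e, he0, he⟩ := EReal.lt_iff_exists_real_btwn.1 hpos
    exact ⟨e, by exact_mod_cast he0, fun R hR => he.le.trans (hmin R hR)⟩
  · exact ⟨1, one_pos, fun Q hQ => absurd ⟨Q, hQ⟩ hne⟩

lemma exists_one_sub_minExcessProbIID_le_exp (hd : d < minDist δ PX PY) :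
    ∃ C κ : ℝ, 0 < κ ∧ ∀ n : ℕ,
      1 - minExcessProbIID δ d PX PY n ≤ C * Real.exp (-(κ * n)) := by
  obtain ⟨e, he0, he⟩ := exists_pos_le_maxMarginalDiv PX PY δ hd
  refine ⟨_, e / 2, half_pos he0, fun n =>
    le_trans ?_ (add_one_pow_mul_exp_neg_le he0 (Nat.card (X × Y)) n)⟩
  -- The types bound requires `n > 0`; at `n = 0` its right side is `1`.
  rcases n.eq_zero_or_pos with rfl | hn
  · simpa using minExcessProbIID_nonneg PX PY δ d 0
  · exact one_sub_minExcessProbIID_le PX PY δ d he hn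

lemma exists_minExcessProbIID_le_exp (hd : minDist δ PX PY < d) :
    ∃ C κ : ℝ, 0 < κ ∧ ∀ n : ℕ,
      minExcessProbIID δ d PX PY n ≤ C * Real.exp (-(κ * n)) := by
  obtain ⟨π, hπ, hmin⟩ := exists_optimal_coupling PX PY δ
  have hp := hπ.1
  obtain ⟨t, ht, hpos⟩ := exists_pos_mul_sub_log_integral_exp π (fun z => δ z.1 z.2)
    (hmin.trans_lt hd)
  refine ⟨1, _, hpos, fun n => ?_⟩
  rcases n.eq_zero_or_pos with rfl | hn
  · simpa using minExcessProbIID_le_one PX PY δ d 0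
  · rw [one_mul]
    exact minExcessProbIID_le_exp hπ δ d ht.le hn

lemma iSup_le_decayExponent_minExcessProbIID {PXY : Measure (X × Y)}
    (h : PXY ∈ couplings PX PY) :
    (⨆ (t : ℝ) (_ : 0 ≤ t),
      ((t * d - Real.log (∫ z, Real.exp (t * δ z.1 z.2) ∂PXY) : ℝ) : EReal))
      ≤ decayExponent (minExcessProbIID δ d PX PY) := by
  refine iSup₂_le fun t ht => coe_le_decayExponent (k := 0) ?_
  filter_upwards [eventually_gt_atTop 0] with n hn
  rw [pow_zero, one_mul]
  exact minExcessProbIID_le_exp h δ d ht hn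

lemma exists_half_sub_le_one_sub_minExcessProbIID (hd : minDist δ PX PY = d) :
    ∃ C : ℝ, ∀ n : ℕ, 0 < n → 1 / 2 - C / √n ≤ 1 - minExcessProbIID δ d PX PY n := by
  obtain ⟨π, hπ, hmin⟩ := exists_optimal_coupling PX PY δ
  have hp := hπ.1
  obtain ⟨C, hC⟩ := exists_half_sub_le_iidLaw π (fun z => δ z.1 z.2) (hmin.trans hd).le
  refine ⟨C, fun n hn => (hC n hn).trans ?_⟩
  have h := measureReal_le_one_sub_minExcessProb (δ := avgDist δ n) (d := d)
    (iidJoint_mem_couplings hπ n)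
  rwa [iidJoint_real_apply] at h

end Main

theorem mainTheorem4 {X Y : Type*} [Finite X] [Finite Y]
    [MeasurableSpace X] [MeasurableSingletonClass X]
    [MeasurableSpace Y] [MeasurableSingletonClass Y]
    (PX : Measure X) [IsProbabilityMeasure PX] (PY : Measure Y) [IsProbabilityMeasure PY]
    (δ : X → Y → ℝ) (d : ℝ) :
    (d < minDist δ PX PY →
      Tendsto (minExcessProbIID δ d PX PY) atTop (𝓝 1) ∧
      (∃ C κ : ℝ, 0 < κ ∧ ∀ n : ℕ,
        1 - minExcessProbIID δ d PX PY n ≤ C * Real.exp (-(κ * n))) ∧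
      decayExponent (fun n => 1 - minExcessProbIID δ d PX PY n)
        = (⨅ Q ∈ distFeasible δ d, maxMarginalDiv PX PY Q) ∧
      ((distFeasible δ d).Nonempty → ∃ Q ∈ distFeasible δ d,
        decayExponent (fun n => 1 - minExcessProbIID δ d PX PY n) = maxMarginalDiv PX PY Q)) ∧
    (minDist δ PX PY < d →
      Tendsto (minExcessProbIID δ d PX PY) atTop (𝓝 0) ∧
      (∃ C κ : ℝ, 0 < κ ∧ ∀ n : ℕ,
        minExcessProbIID δ d PX PY n ≤ C * Real.exp (-(κ * n))) ∧
      ∀ PXY ∈ couplings PX PY,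
        (⨆ (t : ℝ) (_ : 0 ≤ t),
          ((t * d - Real.log (∫ z, Real.exp (t * δ z.1 z.2) ∂PXY) : ℝ) : EReal))
          ≤ decayExponent (minExcessProbIID δ d PX PY)) ∧
    (minDist δ PX PY = d →
      (∃ r : ℕ → ℝ, r =O[atTop] (fun n : ℕ => 1 / √(n : ℝ)) ∧
        ∀ n : ℕ, 0 < n → 1 / 2 + r n ≤ 1 - minExcessProbIID δ d PX PY n) ∧
      ∀ n : ℕ, 0 < n → 1 - minExcessProbIID δ d PX PY n ≤ 1) := by
  refine ⟨fun hd => ?_, fun hd => ?_, fun hd => ?_⟩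
  · obtain ⟨C, κ, hκ, hC⟩ := exists_one_sub_minExcessProbIID_le_exp PX PY δ hd
    refine ⟨?_, ⟨C, κ, hκ, hC⟩, decayExponent_one_sub_minExcessProbIID PX PY δ d, fun hne => ?_⟩
    · have := (tendsto_zero_of_le_exp
        (fun n => sub_nonneg.2 (minExcessProbIID_le_one PX PY δ d n)) hκ hC).const_sub 1
      simpa using this
    · obtain ⟨Q, hQ, hmin⟩ := exists_min_maxMarginalDiv PX PY δ hne
      refine ⟨Q, hQ, ?_⟩
      rw [decayExponent_one_sub_minExcessProbIID]
      exact le_antisymm (iInf₂_le Q hQ) (le_iInf₂ hmin)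
  · obtain ⟨C, κ, hκ, hC⟩ := exists_minExcessProbIID_le_exp PX PY δ hd
    exact ⟨tendsto_zero_of_le_exp (minExcessProbIID_nonneg PX PY δ d) hκ hC, ⟨C, κ, hκ, hC⟩,
      fun PXY h => iSup_le_decayExponent_minExcessProbIID PX PY δ h⟩
  · obtain ⟨C, hC⟩ := exists_half_sub_le_one_sub_minExcessProbIID PX PY δ hd
    refine ⟨⟨fun n => -C * (1 / √(n : ℝ)), (isBigO_refl _ _).const_mul_left _, fun n hn => ?_⟩,
      fun n _ => sub_le_self _ (minExcessProbIID_nonneg PX PY δ d n)⟩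
    refine (le_of_eq ?_).trans (hC n hn)
    ring
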